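/- Let $N\ge 2$, let $\mathbb T=\{z\in\mathbb C:|z|=1\}$ with Haar probability measure, and let $m_0,\dots,m_{N-1}$ be trigonometric polynomials on $\mathbb T$ that form a QMF system, i.e. $\frac1N\sum_{w^N=z}m_i(w)\overline{m_j(w)}=\delta_{ij}$ for all $i,j$ and all $z\in\mathbb T$. Let $S_if(z)=m_i(z)f(z^N)$, $f\in L^2(\mathbb T)$, be the associated wavelet representation of the Cuntz algebra $\mathcal O_N$ on $L^2(\mathbb T)$, and let $P$ be its associated projection-valued measure, i.e. the projection-valued measure on the Borel sets of $\{0,\dots,N-1\}^{\mathbb N}$ whose value on the cylinder of all infinite words that begin with $i_1\dots i_n$ is $S_{i_1}\cdots S_{i_n}(S_{i_1}\cdots S_{i_n})^*$. An atom of the representation is an infinite word $\omega$ with $P(\{\omega\})\neq0$. Then the following are equivalent: (i) the representation has an atom; (ii) there exist $p\ge1$ and $i_0,\dots,i_{p-1}\in\{0,\dots,N-1\}$ (not necessarily distinct) such that for every $j=0,\dots,p-1$ one has $m_{i_j}(z)=a_jz^{k_j}$ with $a_j\in\mathbb T$, $k_j\in\mathbb Z$, and $k_0+Nk_1+\dots+N^{p-1}k_{p-1}$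 is a multiple of $N^p-1$. In particular, if the low-pass condition $m_0(1)=\sqrt N$ holds, then the representation has no atoms. -/

import Mathlib

open MeasureTheory Filter Topology
open scoped ENNReal ComplexConjugate

/-- A projection-valued measure on the measurable space `X`, with values in the orthogonal
projections of the Hilbert space `H`: each measurable set is sent to an orthogonal projection, the
whole space to the identity, and countable additivity holds in the strong operator topology. Sets
that are not measurable are sent to `0` by convention. -/
structure ProjectionValuedMeasure (X : Type*) [MeasurableSpace X] (H : Type*)
    [NormedAddCommGroup H] [InnerProductSpace ℂ H] [CompleteSpace H] where
  /-- The projection of a set. -/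
  proj : Set X → H →L[ℂ] H
  isStarProjection : ∀ A : Set X, MeasurableSet A → IsStarProjection (proj A)
  proj_univ : proj Set.univ = 1
  hasSum_iUnion : ∀ A : ℕ → Set X, (∀ n, MeasurableSet (A n)) →
    Pairwise (Function.onFun Disjoint A) →
    ∀ x : H, HasSum (fun n => proj (A n) x) (proj (⋃ n, A n) x)
  proj_of_not_measurableSet : ∀ A : Set X, ¬ MeasurableSet A → proj A = 0

/-- A representation of the Cuntz algebra `𝒪_N`, `N ≥ 2`, on the Hilbert space `H`: operators
`S 0, …, S (N - 1)` with `S iᴴ S j = δ_ij` and `∑ i, S i S iᴴ = 1`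
(`star` is the Hilbert space adjoint). -/
structure CuntzRep (N : ℕ) (H : Type*)
    [NormedAddCommGroup H] [InnerProductSpace ℂ H] [CompleteSpace H] where
  two_le : 2 ≤ N
  /-- The Cuntz isometries. -/
  S : Fin N → H →L[ℂ] H
  star_mul_mul : ∀ i j, star (S i) * S j = if i = j then 1 else 0
  sum_mul_star : ∑ i, S i * star (S i) = 1

/-- The cylinder set of all infinite words that begin with the finite word `I`. -/
def wordCylinder {N : ℕ} (I : List (Fin N)) : Set (ℕ → Fin N) :=
  {ω | ∀ (k : ℕ) (hk : k < I.length), ω k = I[k]}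

section ProjectionLemmas

variable {H : Type*} [NormedAddCommGroup H] [InnerProductSpace ℂ H] [CompleteSpace H]

theorem starProjection_inner_self {P : H →L[ℂ] H} (hP : IsStarProjection P) (x : H) :
    inner ℂ (P x) x = ((‖P x‖ ^ 2 : ℝ) : ℂ) := by
  have h1 : P (P x) = P x := by
    have := hP.isIdempotentElem
    exact congrArg (fun T : H →L[ℂ] H => T x) this
  have h2 : inner ℂ (P (P x)) x = inner ℂ (P x) (P x) := by
    have := hP.isSelfAdjoint.isSymmetric
    exact this (P x) x
  rw [h1] at h2
  rw [h2, inner_self_eq_norm_sq_to_K]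
  norm_cast

theorem starProjection_ext {P Q : H →L[ℂ] H} (hP : IsStarProjection P) (hQ : IsStarProjection Q)
    (h : ∀ x, ‖P x‖ ^ 2 = ‖Q x‖ ^ 2) : P = Q := by
  have : (P : H →ₗ[ℂ] H) = (Q : H →ₗ[ℂ] H) := by
    rw [← ext_inner_map]
    intro x
    simp only [ContinuousLinearMap.coe_coe]
    rw [starProjection_inner_self hP, starProjection_inner_self hQ, h x]
  exact ContinuousLinearMap.coe_injective this

theorem norm_sq_one_sub {P : H →L[ℂ] H} (hP : IsStarProjection P) (x : H) :
    ‖(1 - P) x‖ ^ 2 = ‖x‖ ^ 2 - ‖P x‖ ^ 2 := by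
  have h1 := starProjection_inner_self hP x
  have h2 := starProjection_inner_self hP.one_sub x
  have h3 : inner ℂ ((1 - P) x) x = inner ℂ x x - inner ℂ (P x) x := by
    simp
  rw [h3, h1, inner_self_eq_norm_sq_to_K] at h2
  have : ((‖x‖ ^ 2 - ‖P x‖ ^ 2 : ℝ) : ℂ) = ((‖(1 - P) x‖ ^ 2 : ℝ) : ℂ) := by
    rw [← h2]; push_cast; rfl
  exact_mod_cast this.symm

theorem isStarProjection_finsetSum {ι : Type*} {Q : ι → H →L[ℂ] H}
    (hQ : ∀ n, IsStarProjection (Q n)) (hd : ∀ i j, i ≠ j → Q i * Q j = 0) (s : Finset ι) :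
    IsStarProjection (∑ n ∈ s, Q n) := by
  classical
  induction s using Finset.induction_on with
  | empty => simp
  | insert a s ha ih =>
    rw [Finset.sum_insert ha]
    refine (hQ a).add ih ?_
    rw [Finset.mul_sum]
    exact Finset.sum_eq_zero fun j hj => hd _ _ (fun h => ha (h ▸ hj))

theorem exists_hasSum_starProjection {Q : ℕ → H →L[ℂ] H}
    (hQ : ∀ n, IsStarProjection (Q n)) (hd : ∀ i j, i ≠ j → Q i * Q j = 0) :
    ∃ P : H →L[ℂ] H, IsStarProjection P ∧ ∀ x, HasSum (fun n => Q n x) (P x) := by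
  classical
  have hs := isStarProjection_finsetSum hQ hd
  choose U hU using fun s : Finset ℕ => isStarProjection_iff_eq_starProjection.1 (hs s)
  choose hU' hU using hU
  have hmono : Monotone U := by
    intro s t hst x hx
    have h1 : (∑ n ∈ s, Q n) x = x := by
      rw [hU s]; exact Submodule.starProjection_eq_self_iff.2 hx
    have h2 : (∑ n ∈ t, Q n) * (∑ n ∈ s, Q n) = ∑ n ∈ s, Q n := by
      rw [← Finset.sum_sdiff hst, add_mul, (hs s).isIdempotentElem, Finset.sum_mul_sum]
      rw [Finset.sum_eq_zero, zero_add]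
      intro i hi
      refine Finset.sum_eq_zero fun j hj => hd _ _ ?_
      rintro rfl
      exact (Finset.mem_sdiff.1 hi).2 hj
    have h3 : (∑ n ∈ t, Q n) x = x := by
      have := congrArg (fun T : H →L[ℂ] H => T x) h2
      change (∑ n ∈ t, Q n) ((∑ n ∈ s, Q n) x) = (∑ n ∈ s, Q n) x at this
      rwa [h1] at this
    rw [hU t] at h3
    exact Submodule.starProjection_eq_self_iff.1 h3
  refine ⟨(⨆ s, U s).topologicalClosure.starProjection, isStarProjection_starProjection, ?_⟩
  intro x
  have := Submodule.starProjection_tendsto_closure_iSup U hmono x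
  simp only [← hU] at this
  simpa [HasSum] using this

/-- If the scalar measures of disjoint sets are given by orthogonal projections, then so is the
scalar measure of their union, by the strong sum of the projections. -/
theorem exists_starProjection_iUnion {X : Type*} [MeasurableSpace X] (μ : H → Measure X)
    (huniv : ∀ x, μ x Set.univ = ENNReal.ofReal (‖x‖ ^ 2)) {A : ℕ → Set X}
    (hA : ∀ n, MeasurableSet (A n)) (hd : Pairwise (Function.onFun Disjoint A))
    {Q : ℕ → H →L[ℂ] H} (hQ : ∀ n, IsStarProjection (Q n))
    (h : ∀ n x, μ x (A n) = ENNReal.ofReal (‖Q n x‖ ^ 2)) :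
    ∃ P : H →L[ℂ] H, IsStarProjection P ∧ (∀ x, HasSum (fun n => Q n x) (P x)) ∧
      ∀ x, μ x (⋃ n, A n) = ENNReal.ofReal (‖P x‖ ^ 2) := by
  have horth : ∀ i j, i ≠ j → Q i * Q j = 0 := by
    intro i j hij
    ext y
    set x := Q j y with hx
    have h1 : Q j x = x := congrArg (fun T : H →L[ℂ] H => T y) (hQ j).isIdempotentElem
    have h2 : μ x (A i) + μ x (A j) ≤ μ x Set.univ := by
      rw [← measure_union (hd hij) (hA j)]
      exact measure_mono (Set.subset_univ _)
    rw [h, h, huniv, h1, ← ENNReal.ofReal_add (by positivity) (by positivity),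
      ENNReal.ofReal_le_ofReal_iff (by positivity)] at h2
    have h3 : ‖Q i x‖ ^ 2 = 0 := le_antisymm (by linarith) (by positivity)
    change Q i x = 0
    simpa using h3
  obtain ⟨P, hP, hs⟩ := exists_hasSum_starProjection hQ horth
  refine ⟨P, hP, hs, fun x => ?_⟩
  rw [measure_iUnion hd hA]
  simp only [h]
  have h4 : HasSum (fun n => ‖Q n x‖ ^ 2) (‖P x‖ ^ 2) := by
    have h5 := (hs x).mapL (innerSL ℂ x)
    have e : ∀ {T : H →L[ℂ] H}, IsStarProjection T →
        innerSL ℂ x (T x) = ((‖T x‖ ^ 2 : ℝ) : ℂ) := by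
      intro T hT
      rw [innerSL_apply_apply, ← inner_conj_symm, starProjection_inner_self hT,
        Complex.conj_ofReal]
    simp only [e hP, e (hQ _)] at h5
    exact_mod_cast h5
  rw [← ENNReal.ofReal_tsum_of_nonneg (fun _ => by positivity) h4.summable, h4.tsum_eq]

/-- If the scalar measures take values given by orthogonal projections on a generating π-system,
then they do so on all measurable sets. -/
theorem exists_starProjection_of_measure {X : Type*} [mX : MeasurableSpace X]
    {C : Set (Set X)} (hgen : mX = MeasurableSpace.generateFrom C) (hpi : IsPiSystem C)
    (μ : H → Measure X) (huniv : ∀ x, μ x Set.univ = ENNReal.ofReal (‖x‖ ^ 2))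
    (hC : ∀ A ∈ C, ∃ P : H →L[ℂ] H, IsStarProjection P ∧
      ∀ x, μ x A = ENNReal.ofReal (‖P x‖ ^ 2))
    (A : Set X) (hA : MeasurableSet A) :
    ∃ P : H →L[ℂ] H, IsStarProjection P ∧ ∀ x, μ x A = ENNReal.ofReal (‖P x‖ ^ 2) := by
  induction A, hA using MeasurableSpace.induction_on_inter hgen hpi with
  | empty => exact ⟨0, .zero _, fun x => by simp⟩
  | basic A hA => exact hC A hA
  | compl A hA ih =>
    obtain ⟨P, hP, h⟩ := ih
    refine ⟨1 - P, hP.one_sub, fun x => ?_⟩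
    rw [norm_sq_one_sub hP, ENNReal.ofReal_sub _ (by positivity),
      measure_compl hA (by rw [h]; exact ENNReal.ofReal_ne_top), huniv, h]
  | iUnion A hd hA ih =>
    choose Q hQ h using ih
    obtain ⟨P, hP, -, hs⟩ := exists_starProjection_iUnion μ huniv hA hd hQ h
    exact ⟨P, hP, hs⟩

/-- The projection-valued measure with given scalar measures. -/
theorem exists_pvm_of_measure {X : Type*} [mX : MeasurableSpace X]
    {C : Set (Set X)} (hgen : mX = MeasurableSpace.generateFrom C) (hpi : IsPiSystem C)
    (μ : H → Measure X) (huniv : ∀ x, μ x Set.univ = ENNReal.ofReal (‖x‖ ^ 2))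
    (hC : ∀ A ∈ C, ∃ P : H →L[ℂ] H, IsStarProjection P ∧
      ∀ x, μ x A = ENNReal.ofReal (‖P x‖ ^ 2)) :
    ∃ P : ProjectionValuedMeasure X H, ∀ A, MeasurableSet A →
      ∀ x, μ x A = ENNReal.ofReal (‖P.proj A x‖ ^ 2) := by
  classical
  choose P hP h using exists_starProjection_of_measure hgen hpi μ huniv hC
  have key : ∀ {T : H →L[ℂ] H} {A : Set X} (hA : MeasurableSet A), IsStarProjection T →
      (∀ x, μ x A = ENNReal.ofReal (‖T x‖ ^ 2)) → T = P A hA := by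
    intro T A hA hT h'
    refine starProjection_ext hT (hP A hA) fun x => ?_
    have := (h' x).symm.trans (h A hA x)
    rwa [ENNReal.ofReal_eq_ofReal_iff (by positivity) (by positivity)] at this
  refine ⟨⟨fun A => if hA : MeasurableSet A then P A hA else 0, ?_, ?_, ?_, ?_⟩, ?_⟩
  · intro A hA
    simpa [hA] using hP A hA
  · simp only [MeasurableSet.univ, dif_pos]
    exact (key .univ (.one _) (by simpa using huniv)).symm
  · intro A hA hd x
    simp only [hA, MeasurableSet.iUnion hA, dif_pos]
    obtain ⟨T, hT, hs, hm⟩ := exists_starProjection_iUnion μ huniv hA hd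
      (fun n => hP (A n) (hA n)) (fun n x => h (A n) (hA n) x)
    rw [← key (.iUnion hA) hT hm]
    exact hs x
  · intro A hA
    simp [hA]
  · intro A hA x
    simpa [hA] using h A hA x

end ProjectionLemmas

namespace ProjectionValuedMeasure

variable {X : Type*} [mX : MeasurableSpace X] {H : Type*} [NormedAddCommGroup H]
  [InnerProductSpace ℂ H] [CompleteSpace H]

theorem proj_empty (P : ProjectionValuedMeasure X H) : P.proj ∅ = 0 := by
  ext x
  have h := P.hasSum_iUnion (fun _ => ∅) (fun _ => .empty) (fun _ _ _ => by simp) x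
  have h1 := h.summable.tendsto_atTop_zero
  exact tendsto_nhds_unique tendsto_const_nhds h1

theorem proj_compl (P : ProjectionValuedMeasure X H) {A : Set X} (hA : MeasurableSet A) :
    P.proj Aᶜ = 1 - P.proj A := by
  ext x
  let f : ℕ → Set X := fun n => if n = 0 then A else if n = 1 then Aᶜ else ∅
  have hf : ∀ n, MeasurableSet (f n) := by
    intro n
    simp only [f]
    split_ifs
    exacts [hA, hA.compl, .empty]
  have hd : Pairwise (Function.onFun Disjoint f) := by
    intro i j hij
    rw [Function.onFun, Set.disjoint_left]
    intro y
    simp only [f]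
    split_ifs <;> simp_all
  have hU : ⋃ n, f n = Set.univ := by
    refine Set.eq_univ_of_forall fun y => ?_
    by_cases hy : y ∈ A
    · exact Set.mem_iUnion.2 ⟨0, by simpa [f] using hy⟩
    · exact Set.mem_iUnion.2 ⟨1, by simpa [f] using hy⟩
  have h := P.hasSum_iUnion f hf hd x
  have h2 : HasSum (fun n => P.proj (f n) x) (∑ n ∈ Finset.range 2, P.proj (f n) x) := by
    refine hasSum_sum_of_ne_finset_zero fun n hn => ?_
    have h0 : n ≠ 0 := by rintro rfl; simp at hn
    have h1 : n ≠ 1 := by rintro rfl; simp at hn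
    simp [f, h0, h1, P.proj_empty]
  have h3 := h.unique h2
  rw [hU, P.proj_univ] at h3
  simp [Finset.sum_range_succ, f] at h3
  rw [sub_apply, one_apply_eq_self]
  exact eq_sub_of_add_eq' h3.symm

/-- Two projection-valued measures that agree on a generating π-system are equal. -/
theorem ext_of_generateFrom {C : Set (Set X)} (hgen : mX = MeasurableSpace.generateFrom C)
    (hpi : IsPiSystem C) {P Q : ProjectionValuedMeasure X H}
    (h : ∀ A ∈ C, P.proj A = Q.proj A) : P = Q := by
  have key : ∀ A, MeasurableSet A → P.proj A = Q.proj A := by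
    intro A hA
    induction A, hA using MeasurableSpace.induction_on_inter hgen hpi with
    | empty => rw [proj_empty, proj_empty]
    | basic A hA => exact h A hA
    | compl A hA ih => rw [proj_compl _ hA, proj_compl _ hA, ih]
    | iUnion A hd hA ih =>
      ext x
      have h1 := P.hasSum_iUnion A hA hd x
      simp only [ih] at h1
      exact h1.unique (Q.hasSum_iUnion A hA hd x)
  have h2 : P.proj = Q.proj := by
    funext A
    by_cases hA : MeasurableSet A
    · exact key A hA
    · rw [P.proj_of_not_measurableSet A hA, Q.proj_of_not_measurableSet A hA]
  cases P; cases Q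
  congr

end ProjectionValuedMeasure

theorem measurableSet_wordCylinder {N : ℕ} (I : List (Fin N)) :
    MeasurableSet (wordCylinder I) := by
  have : wordCylinder I = ⋂ k : Fin I.length, (fun ω : ℕ → Fin N => ω k) ⁻¹' {I[k]} := by
    ext ω
    simp [wordCylinder, Fin.forall_iff]
  rw [this]
  exact .iInter fun k => measurable_pi_apply _ (measurableSet_singleton _)

theorem isClopen_wordCylinder {N : ℕ} (I : List (Fin N)) : IsClopen (wordCylinder I) := by
  have : wordCylinder I = ⋂ k : Fin I.length, (fun ω : ℕ → Fin N => ω k) ⁻¹' {I[k]} := by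
    ext ω
    simp [wordCylinder, Fin.forall_iff]
  rw [this]
  exact isClopen_iInter_of_finite fun k => (isClopen_discrete _).preimage (continuous_apply _)

theorem isPiSystem_wordCylinder {N : ℕ} :
    IsPiSystem (Set.range (wordCylinder : List (Fin N) → Set (ℕ → Fin N))) := by
  rintro _ ⟨I, rfl⟩ _ ⟨J, rfl⟩ ⟨ω, hI, hJ⟩
  wlog h : I.length ≤ J.length generalizing I J
  · rw [Set.inter_comm]
    exact this J I hJ hI (by omega)
  refine ⟨J, ?_⟩
  symm
  refine Set.inter_eq_right.2 fun η hη k hk => ?_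
  rw [hη k (by omega), ← hJ k (by omega), hI k hk]

theorem generateFrom_wordCylinder {N : ℕ} :
    (inferInstance : MeasurableSpace (ℕ → Fin N)) = MeasurableSpace.generateFrom
      (Set.range (wordCylinder : List (Fin N) → Set (ℕ → Fin N))) := by
  apply le_antisymm
  · refine iSup_le fun k => ?_
    rw [← measurable_iff_comap_le]
    refine @measurable_to_countable' _ _ _ _ (_) _ fun a => ?_
    have : (fun ω : ℕ → Fin N => ω k) ⁻¹' {a} =
        ⋃ I ∈ {I : List (Fin N) | I.length = k + 1 ∧ I[k]? = some a}, wordCylinder I := by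
      ext ω
      simp only [Set.mem_preimage, Set.mem_singleton_iff, Set.mem_iUnion]
      constructor
      · intro h
        refine ⟨List.ofFn fun j : Fin (k + 1) => ω j, ?_, ?_⟩
        · simp [h, -List.ofFn_succ]
        · intro j hj
          simp [-List.ofFn_succ]
      · rintro ⟨I, ⟨h1, h2⟩, h3⟩
        rw [h3 k (by omega)]
        rw [List.getElem?_eq_getElem (by omega)] at h2
        exact Option.some.inj h2
    rw [this]
    exact @MeasurableSet.biUnion _ _ (_) _ _ (Set.to_countable _)
      fun I _ => MeasurableSpace.measurableSet_generateFrom ⟨I, rfl⟩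
  · refine MeasurableSpace.generateFrom_le ?_
    rintro _ ⟨I, rfl⟩
    exact measurableSet_wordCylinder I

namespace CuntzRep

variable {N : ℕ} {H : Type*} [NormedAddCommGroup H] [InnerProductSpace ℂ H] [CompleteSpace H]

/-- `S_I = S_{i₁} ⋯ S_{iₙ}` for a finite word `I = i₁ … iₙ`. -/
def word (R : CuntzRep N H) (I : List (Fin N)) : H →L[ℂ] H := (I.map R.S).prod

theorem star_word_mul_word (R : CuntzRep N H) (I : List (Fin N)) :
    star (R.word I) * R.word I = 1 := by
  induction I with
  | nil => simp [word]
  | cons i I ih =>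
    have h1 : R.word (i :: I) = R.S i * R.word I := by simp [word]
    have h2 := R.star_mul_mul i i
    rw [if_pos rfl] at h2
    rw [h1, star_mul, mul_assoc, ← mul_assoc (star (R.S i)), h2, one_mul, ih]

theorem isStarProjection_word (R : CuntzRep N H) (I : List (Fin N)) :
    IsStarProjection (R.word I * star (R.word I)) := by
  refine ⟨?_, by simp [IsSelfAdjoint]⟩
  change _ * _ = _
  rw [mul_assoc, ← mul_assoc (star _), star_word_mul_word, one_mul]

theorem norm_word (R : CuntzRep N H) (I : List (Fin N)) (x : H) :
    ‖R.word I x‖ = ‖x‖ := by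
  have h : inner ℂ (R.word I x) (R.word I x) = inner ℂ x x := by
    rw [← ContinuousLinearMap.adjoint_inner_left]
    congr 1
    exact congrArg (fun T : H →L[ℂ] H => T x) (R.star_word_mul_word I)
  rw [inner_self_eq_norm_sq_to_K, inner_self_eq_norm_sq_to_K] at h
  have h' : ‖R.word I x‖ ^ 2 = ‖x‖ ^ 2 := by exact_mod_cast h
  exact (pow_left_inj₀ (norm_nonneg _) (norm_nonneg _) two_ne_zero).1 h'

theorem sum_norm_sq (R : CuntzRep N H) (x : H) : ∑ i, ‖star (R.S i) x‖ ^ 2 = ‖x‖ ^ 2 := by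
  have h := congrArg (fun T : H →L[ℂ] H => inner ℂ (T x) x) R.sum_mul_star
  have h1 : ∀ i, inner ℂ ((R.S i * star (R.S i)) x) x =
      ((‖star (R.S i) x‖ ^ 2 : ℝ) : ℂ) := by
    intro i
    change inner ℂ (R.S i (star (R.S i) x)) x = _
    rw [← ContinuousLinearMap.adjoint_inner_right, ← ContinuousLinearMap.star_eq_adjoint,
      inner_self_eq_norm_sq_to_K]
    norm_cast
  simp only [sum_apply, sum_inner, h1] at h
  rw [one_apply_eq_self, inner_self_eq_norm_sq_to_K] at h
  apply Complex.ofReal_injective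
  push_cast at h ⊢
  exact h

/-- The word `i ω`. -/
def consWord (i : Fin N) (ω : ℕ → Fin N) : ℕ → Fin N
  | 0 => i
  | k + 1 => ω k

theorem measurable_consWord (i : Fin N) : Measurable (consWord i) := by
  refine measurable_pi_lambda _ fun k => ?_
  cases k with
  | zero => exact measurable_const
  | succ k => exact measurable_pi_apply k

theorem consWord_preimage (i j : Fin N) (I : List (Fin N)) :
    consWord i ⁻¹' wordCylinder (j :: I) = if i = j then wordCylinder I else ∅ := by
  ext ω
  split_ifs with h
  · subst h
    constructor
    · intro hω k hk
      exact hω (k + 1) (by simpa using hk)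
    · intro hω k hk
      cases k with
      | zero => rfl
      | succ k => exact hω k (by simpa using hk)
  · simp only [Set.mem_preimage, Set.mem_empty_iff_false, iff_false]
    intro hω
    exact h (hω 0 (by simp))

theorem exists_measure_le (R : CuntzRep N H) (n : ℕ) (x : H) :
    ∃ μ : Measure (ℕ → Fin N), ∀ I : List (Fin N), I.length ≤ n →
      μ (wordCylinder I) = ENNReal.ofReal (‖star (R.word I) x‖ ^ 2) := by
  induction n generalizing x with
  | zero =>
    have : Nonempty (Fin N) := ⟨⟨0, by have := R.two_le; omega⟩⟩
    refine ⟨ENNReal.ofReal (‖x‖ ^ 2) • Measure.dirac (fun _ => Classical.arbitrary _),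
      fun I hI => ?_⟩
    obtain rfl : I = [] := by simpa using hI
    have : wordCylinder ([] : List (Fin N)) = Set.univ := by ext; simp [wordCylinder]
    simp [this, word]
  | succ n ih =>
    choose μ hμ using ih
    refine ⟨∑ i, (μ (star (R.S i) x)).map (consWord i), fun I hI => ?_⟩
    rw [Measure.finsetSum_apply]
    simp only [Measure.map_apply (measurable_consWord _) (measurableSet_wordCylinder _)]
    cases I with
    | nil =>
      have : wordCylinder ([] : List (Fin N)) = Set.univ := by ext; simp [wordCylinder]
      have h0 : ∀ y, μ y Set.univ = ENNReal.ofReal (‖y‖ ^ 2) := by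
        intro y
        have := hμ y [] (by simp)
        simpa [‹wordCylinder ([] : List (Fin N)) = Set.univ›, word] using this
      simp only [this, Set.preimage_univ, h0]
      rw [← ENNReal.ofReal_sum_of_nonneg (fun _ _ => by positivity), R.sum_norm_sq]
      simp [word]
    | cons j I =>
      rw [Finset.sum_eq_single j]
      · rw [consWord_preimage, if_pos rfl, hμ _ I (by simpa using hI)]
        simp [word]
      · intro i _ hij
        rw [consWord_preimage, if_neg hij, measure_empty]
      · simp

theorem exists_measure (R : CuntzRep N H) (x : H) :
    ∃ μ : Measure (ℕ → Fin N), ∀ I : List (Fin N),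
      μ (wordCylinder I) = ENNReal.ofReal (‖star (R.word I) x‖ ^ 2) := by
  have hnil : wordCylinder ([] : List (Fin N)) = Set.univ := by ext; simp [wordCylinder]
  wlog hx : ‖x‖ = 1 generalizing x
  · by_cases h0 : x = 0
    · exact ⟨0, fun I => by simp [h0]⟩
    obtain ⟨μ, hμ⟩ := this ((‖x‖⁻¹ : ℂ) • x) (by simp [norm_smul, h0])
    refine ⟨ENNReal.ofReal (‖x‖ ^ 2) • μ, fun I => ?_⟩
    rw [Measure.smul_apply, hμ, smul_eq_mul, ← ENNReal.ofReal_mul (by positivity)]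
    congr 1
    rw [map_smul, norm_smul, mul_pow, ← mul_assoc]
    have : ‖x‖ ≠ 0 := by simpa using h0
    simp [this]
  choose μ hμ using fun n => R.exists_measure_le n x
  have hp : ∀ n, IsProbabilityMeasure (μ n) := by
    intro n
    refine ⟨?_⟩
    rw [← hnil, hμ n [] (by simp)]
    simp [word, hx]
  let ν : ℕ → ProbabilityMeasure (ℕ → Fin N) := fun n => ⟨μ n, hp n⟩
  let F : Ultrafilter (ProbabilityMeasure (ℕ → Fin N)) := (hyperfilter ℕ).map ν
  have hF : Tendsto ν (hyperfilter ℕ) (𝓝 F.lim) := F.le_nhds_lim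
  refine ⟨(F.lim : Measure (ℕ → Fin N)), fun I => ?_⟩
  have h1 := ProbabilityMeasure.tendsto_measure_of_null_frontier_of_tendsto' hF
    (E := wordCylinder I) (by rw [(isClopen_wordCylinder I).frontier_eq]; simp)
  have h2 : Tendsto (fun n => (ν n : Measure (ℕ → Fin N)) (wordCylinder I)) (hyperfilter ℕ)
      (𝓝 (ENNReal.ofReal (‖star (R.word I) x‖ ^ 2))) := by
    refine tendsto_const_nhds.congr' ?_
    have h3 : ∀ᶠ n in (atTop : Filter ℕ), I.length ≤ n := eventually_ge_atTop _
    have h4 : ∀ᶠ n in (hyperfilter ℕ : Filter ℕ), I.length ≤ n :=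
      Nat.hyperfilter_le_atTop h3
    filter_upwards [h4] with n hn
    exact (hμ n I hn).symm
  exact tendsto_nhds_unique h1 h2

/-- The projections `S_I S_Iᴴ` extend to a projection-valued measure. -/
theorem exists_pvm (R : CuntzRep N H) : ∃ P : ProjectionValuedMeasure (ℕ → Fin N) H,
    ∀ I : List (Fin N), P.proj (wordCylinder I) = R.word I * star (R.word I) := by
  choose μ hμ using R.exists_measure
  have hn : ∀ I x, ‖(R.word I * star (R.word I)) x‖ = ‖star (R.word I) x‖ :=
    fun I x => R.norm_word I _
  have huniv : ∀ x, μ x Set.univ = ENNReal.ofReal (‖x‖ ^ 2) := by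
    intro x
    have hnil : wordCylinder ([] : List (Fin N)) = Set.univ := by ext; simp [wordCylinder]
    rw [← hnil, hμ]
    simp [word]
  obtain ⟨P, hP⟩ := exists_pvm_of_measure generateFrom_wordCylinder isPiSystem_wordCylinder μ huniv
    (by
      rintro _ ⟨I, rfl⟩
      exact ⟨_, R.isStarProjection_word I, fun x => by rw [hn, hμ]⟩)
  refine ⟨P, fun I => ?_⟩
  refine starProjection_ext (P.isStarProjection _ (measurableSet_wordCylinder I))
    (R.isStarProjection_word I) fun x => ?_
  have := hP _ (measurableSet_wordCylinder I) x
  rw [hμ, ENNReal.ofReal_eq_ofReal_iff (by positivity) (by positivity)] at this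
  rw [hn, this]

/-- The projection-valued measure on the infinite words associated to the representation: it
extends `P(C(I)) = S_I S_Iᴴ` from the cylinder sets to all Borel sets. -/
noncomputable def pvm (R : CuntzRep N H) : ProjectionValuedMeasure (ℕ → Fin N) H :=
  R.exists_pvm.choose

theorem pvm_wordCylinder (R : CuntzRep N H) (I : List (Fin N)) :
    R.pvm.proj (wordCylinder I) = R.word I * star (R.word I) :=
  R.exists_pvm.choose_spec I

theorem pvm_unique (R : CuntzRep N H) {P : ProjectionValuedMeasure (ℕ → Fin N) H}
    (hP : ∀ I : List (Fin N), P.proj (wordCylinder I) = R.word I * star (R.word I)) :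
    P = R.pvm := by
  refine ProjectionValuedMeasure.ext_of_generateFrom generateFrom_wordCylinder
    isPiSystem_wordCylinder ?_
  rintro _ ⟨I, rfl⟩
  rw [hP, pvm_wordCylinder]

/-- The infinite word `ω` is an atom of the representation. -/
def IsAtom (R : CuntzRep N H) (ω : ℕ → Fin N) : Prop := R.pvm.proj {ω} ≠ 0

/-- The representation has an atom. -/
def HasAtom (R : CuntzRep N H) : Prop := ∃ ω, R.IsAtom ω

end CuntzRep

/-- The Borel σ-algebra of the unit circle. -/
noncomputable instance instMeasurableSpaceCircle : MeasurableSpace Circle := borel Circle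

instance instBorelSpaceCircle : BorelSpace Circle := ⟨rfl⟩

/-- The Haar probability measure on the unit circle. -/
noncomputable def circleHaar : Measure Circle := Measure.haarMeasure ⊤

instance instIsProbabilityMeasureCircleHaar : IsProbabilityMeasure circleHaar :=
  ⟨Measure.haarMeasure_self⟩

instance instIsHaarMeasureCircleHaar : circleHaar.IsHaarMeasure :=
  Measure.isHaarMeasure_haarMeasure _

/-- A QMF system: `(1/N) ∑_{w^N = z} m_i(w) conj (m_j(w)) = δ_ij` for all `z` on the circle. -/
def IsQMF {N : ℕ} (m : Fin N → C(Circle, ℂ)) : Prop :=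
  ∀ (i j : Fin N) (z : Circle),
    (1 / (N : ℂ)) * ∑ᶠ w ∈ {w : Circle | w ^ N = z}, m i w * conj (m j w) = if i = j then 1 else 0

/-- `f` is a trigonometric polynomial, `f(z) = ∑ c_n z^n` with finitely many nonzero `c_n`,
`n ∈ ℤ`. -/
def IsTrigPolynomial (f : C(Circle, ℂ)) : Prop :=
  ∃ c : ℤ →₀ ℂ, ∀ z : Circle, f z = c.sum fun n a => a * (z : ℂ) ^ n

theorem circle_pow_surjective {N : ℕ} (hN : N ≠ 0) :
    Function.Surjective (fun z : Circle => z ^ N) := by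
  intro z
  refine ⟨Circle.exp (Complex.arg z / N), ?_⟩
  have : (N : ℝ) ≠ 0 := by exact_mod_cast hN
  simp only
  rw [← Circle.exp_nsmul, nsmul_eq_mul, mul_div_cancel₀ _ this, Circle.exp_arg]

theorem measurePreserving_circle_pow {N : ℕ} (hN : N ≠ 0) :
    MeasurePreserving (fun z : Circle => z ^ N) circleHaar circleHaar :=
  (powMonoidHom N : Circle →* Circle).measurePreserving (continuous_pow N)
    (circle_pow_surjective hN) rfl

/-- The operator `f(z) ↦ m(z) f(z^N)` on `L²` of the circle. -/
noncomputable def waveletOp {N : ℕ} (hN : 2 ≤ N) (m : C(Circle, ℂ)) :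
    Lp ℂ 2 circleHaar →L[ℂ] Lp ℂ 2 circleHaar :=
  ((ContinuousLinearMap.mul ℂ ℂ).holderL circleHaar ∞ 2 2 (ContinuousMap.toLp ∞ circleHaar ℂ m)) ∘L
    (Lp.compMeasurePreservingₗᵢ ℂ (fun z : Circle => z ^ N)
      (measurePreserving_circle_pow (by omega))).toContinuousLinearMap

theorem coeFn_waveletOp {N : ℕ} (hN : 2 ≤ N) (m : C(Circle, ℂ)) (f : Lp ℂ 2 circleHaar) :
    waveletOp hN m f =ᵐ[circleHaar] fun z => m z * f (z ^ N) := by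
  have h1 := (ContinuousLinearMap.mul ℂ ℂ).coeFn_holder (r := 2) (ContinuousMap.toLp ∞ circleHaar ℂ m)
    (Lp.compMeasurePreserving (fun z : Circle => z ^ N)
      (measurePreserving_circle_pow (by omega)) f)
  have h2 := ContinuousMap.coeFn_toLp (p := ∞) (𝕜 := ℂ) circleHaar m
  have h3 := Lp.coeFn_compMeasurePreserving f
    (measurePreserving_circle_pow (show N ≠ 0 by omega))
  have h4 : waveletOp hN m f = (ContinuousLinearMap.mul ℂ ℂ).holder 2
    (ContinuousMap.toLp ∞ circleHaar ℂ m) (Lp.compMeasurePreserving (fun z : Circle => z ^ N)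
      (measurePreserving_circle_pow (by omega)) f) := rfl
  rw [h4]
  filter_upwards [h1, h2, h3] with z h1 h2 h3
  rw [h1, h2, h3]
  rfl

section QMF

variable {N : ℕ}

/-- A primitive `N`-th root of unity. -/
noncomputable def circleRoot (N : ℕ) : Circle := Circle.exp (2 * Real.pi / N)

theorem isPrimitiveRoot_circleRoot (hN : N ≠ 0) :
    IsPrimitiveRoot ((circleRoot N : Circle) : ℂ) N := by
  have := Complex.isPrimitiveRoot_exp N hN
  convert this using 1
  rw [circleRoot, Circle.coe_exp]
  congr 1
  push_cast
  ring

theorem bijOn_fiber (hN : N ≠ 0) (z : Circle) :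
    Set.BijOn (fun k : Fin N => circleRoot N ^ (k : ℕ) * z) Set.univ {w | w ^ N = z ^ N} := by
  have hp := isPrimitiveRoot_circleRoot hN
  have h1 : circleRoot N ^ N = 1 := by
    apply Circle.ext
    simpa using hp.pow_eq_one
  refine ⟨fun k _ => ?_, fun k _ l _ h => ?_, fun w hw => ?_⟩
  · simp only [Set.mem_ofPred_eq]
    rw [mul_pow, ← pow_mul, mul_comm, mul_comm (k : ℕ), pow_mul, h1, one_pow, mul_one]
  · have h2 := mul_right_cancel h
    have h3 := congrArg (fun w : Circle => (w : ℂ)) h2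
    simp only [Circle.coe_pow] at h3
    exact Fin.ext (hp.pow_inj k.2 l.2 h3)
  · have h2 : (w / z) ^ N = 1 := by rw [div_pow, hw, div_self']
    have : NeZero N := ⟨hN⟩
    obtain ⟨k, hk, hk'⟩ := hp.eq_pow_of_pow_eq_one (ξ := ((w / z : Circle) : ℂ)) (by
      rw [← Circle.coe_pow, h2, Circle.coe_one])
    refine ⟨⟨k, hk⟩, trivial, ?_⟩
    have h3 : circleRoot N ^ k = w / z := by
      apply Circle.ext
      rw [Circle.coe_pow, hk']
    simp only [h3, div_mul_cancel]

theorem IsQMF.sum_root {m : Fin N → C(Circle, ℂ)} (hm : IsQMF m) (hN : N ≠ 0) (i j : Fin N)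
    (z : Circle) :
    (1 / (N : ℂ)) * ∑ k : Fin N, m i (circleRoot N ^ (k : ℕ) * z) *
      conj (m j (circleRoot N ^ (k : ℕ) * z)) = if i = j then 1 else 0 := by
  rw [← hm i j (z ^ N)]
  congr 1
  rw [← finsum_eq_sum_of_fintype, ← finsum_mem_univ]
  exact finsum_mem_eq_of_bijOn _ (bijOn_fiber hN z) fun _ _ => rfl

/-- The filter matrix is unitary, hence its columns are orthonormal too. -/
theorem IsQMF.sum_filter {m : Fin N → C(Circle, ℂ)} (hm : IsQMF m) (hN : N ≠ 0) (k l : Fin N)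
    (z : Circle) :
    (1 / (N : ℂ)) * ∑ i : Fin N, conj (m i (circleRoot N ^ (k : ℕ) * z)) *
      m i (circleRoot N ^ (l : ℕ) * z) = if k = l then 1 else 0 := by
  let A : Matrix (Fin N) (Fin N) ℂ := fun i k => m i (circleRoot N ^ (k : ℕ) * z)
  let B : Matrix (Fin N) (Fin N) ℂ := fun k i =>
    (1 / (N : ℂ)) * conj (m i (circleRoot N ^ (k : ℕ) * z))
  have h1 : A * B = 1 := by
    ext i j
    rw [Matrix.mul_apply, Matrix.one_apply, ← hm.sum_root hN i j z, Finset.mul_sum]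
    exact Finset.sum_congr rfl fun k _ => by simp only [A, B]; ring
  have h2 : B * A = 1 := mul_eq_one_comm.1 h1
  have h3 := congrFun (congrFun h2 k) l
  rw [Matrix.mul_apply, Matrix.one_apply] at h3
  rw [← h3, Finset.mul_sum]
  exact Finset.sum_congr rfl fun i _ => by simp only [A, B]; ring

theorem integral_average (hN : N ≠ 0) {K : Circle → ℂ} (hK : Integrable K circleHaar) :
    ∫ z, (1 / (N : ℂ)) * ∑ k : Fin N, K (circleRoot N ^ (k : ℕ) * z) ∂circleHaar =
      ∫ z, K z ∂circleHaar := by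
  rw [integral_const_mul, integral_finsetSum _ fun k _ => hK.comp_mul_left _]
  simp only [integral_mul_left_eq_self]
  have : (N : ℂ) ≠ 0 := by exact_mod_cast hN
  simp [this]

theorem IsQMF.inner_waveletOp {m : Fin N → C(Circle, ℂ)} (hm : IsQMF m) (hN : 2 ≤ N)
    (i j : Fin N) (f g : Lp ℂ 2 circleHaar) :
    inner ℂ (waveletOp hN (m i) f) (waveletOp hN (m j) g) = if i = j then inner ℂ f g else 0 := by
  have hN0 : N ≠ 0 := by omega
  let K : Circle → ℂ := fun z => (m j z * conj (m i z)) * (g (z ^ N) * conj (f (z ^ N)))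
  have hK : (fun z => inner ℂ (waveletOp hN (m i) f z) (waveletOp hN (m j) g z)) =ᵐ[circleHaar]
      K := by
    filter_upwards [coeFn_waveletOp hN (m i) f, coeFn_waveletOp hN (m j) g] with z h1 h2
    rw [h1, h2, RCLike.inner_apply, map_mul]
    simp only [K]
    ring
  have hKi : Integrable K circleHaar := (L2.integrable_inner _ _).congr hK
  rw [L2.inner_def, integral_congr_ae hK, ← integral_average hN0 hKi]
  have hpow : ∀ (k : Fin N) (z : Circle), (circleRoot N ^ (k : ℕ) * z) ^ N = z ^ N :=
    fun k z => (bijOn_fiber hN0 z).mapsTo (Set.mem_univ k)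
  have e : ∀ z, (1 / (N : ℂ)) * ∑ k : Fin N, K (circleRoot N ^ (k : ℕ) * z) =
      (if j = i then 1 else 0) * (g (z ^ N) * conj (f (z ^ N))) := by
    intro z
    rw [← hm.sum_root hN0 j i z]
    simp only [K, hpow]
    rw [← Finset.sum_mul, mul_assoc]
  simp only [e]
  rw [integral_const_mul]
  by_cases hij : i = j
  · subst hij
    rw [if_pos rfl, if_pos rfl, one_mul, L2.inner_def]
    have hmp := measurePreserving_circle_pow hN0
    have hint := L2.integrable_inner (𝕜 := ℂ) f g
    have := integral_map (μ := circleHaar) hmp.measurable.aemeasurable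
      (f := fun z => inner ℂ (f z) (g z)) (by rw [hmp.map_eq]; exact hint.1)
    rw [hmp.map_eq] at this
    rw [this]
    rfl
  · rw [if_neg (Ne.symm hij), if_neg hij, zero_mul]

theorem IsQMF.star_mul_waveletOp {m : Fin N → C(Circle, ℂ)} (hm : IsQMF m) (hN : 2 ≤ N)
    (i j : Fin N) :
    star (waveletOp hN (m i)) * waveletOp hN (m j) = if i = j then 1 else 0 := by
  refine ContinuousLinearMap.ext fun f => ext_inner_left ℂ fun g => ?_
  change inner ℂ g (star (waveletOp hN (m i)) (waveletOp hN (m j) f)) = _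
  rw [ContinuousLinearMap.star_eq_adjoint, ContinuousLinearMap.adjoint_inner_right,
    hm.inner_waveletOp]
  split_ifs <;> simp

/-- Every continuous function is `∑ m_i(z) f_i(z^N)` for suitable continuous `f_i`. -/
theorem IsQMF.exists_decomposition {m : Fin N → C(Circle, ℂ)} (hm : IsQMF m) (hN : N ≠ 0)
    (f : C(Circle, ℂ)) :
    ∃ F : Fin N → C(Circle, ℂ), ∀ z, f z = ∑ i, m i z * F i (z ^ N) := by
  let P : C(Circle, Circle) := ⟨fun z => z ^ N, continuous_pow N⟩
  have hP : IsQuotientMap P :=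
    P.continuous.isClosedMap.isQuotientMap P.continuous (circle_pow_surjective hN)
  let G : Fin N → C(Circle, ℂ) := fun i =>
    ⟨fun z => (1 / (N : ℂ)) * ∑ k : Fin N, conj (m i (circleRoot N ^ (k : ℕ) * z)) *
      f (circleRoot N ^ (k : ℕ) * z), by fun_prop⟩
  have hG : ∀ i z, G i z =
      (1 / (N : ℂ)) * ∑ᶠ w ∈ {w : Circle | w ^ N = z ^ N}, conj (m i w) * f w := by
    intro i z
    simp only [G, ContinuousMap.coe_mk]
    congr 1
    rw [← finsum_eq_sum_of_fintype, ← finsum_mem_univ]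
    exact finsum_mem_eq_of_bijOn _ (bijOn_fiber hN z) fun _ _ => rfl
  have hfac : ∀ i, Function.FactorsThrough (G i) P := by
    intro i z w hzw
    have : z ^ N = w ^ N := hzw
    rw [hG, hG, this]
  refine ⟨fun i => hP.lift (G i) (hfac i), fun z => ?_⟩
  have h1 : ∀ i, hP.lift (G i) (hfac i) (z ^ N) = G i z := by
    intro i
    have := hP.lift_comp (G i) (hfac i)
    exact congrArg (fun g : C(Circle, ℂ) => g z) this
  simp only [h1, G, ContinuousMap.coe_mk]

  have h2 : ∀ k : Fin N, (1 / (N : ℂ)) * ∑ i : Fin N,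
      conj (m i (circleRoot N ^ (k : ℕ) * z)) * m i z =
        if k = ⟨0, by omega⟩ then 1 else 0 := by
    intro k
    have := hm.sum_filter hN k ⟨0, by omega⟩ z
    simpa using this
  calc f z = ∑ k : Fin N, (if k = ⟨0, by omega⟩ then 1 else 0) *
        f (circleRoot N ^ (k : ℕ) * z) := by simp
    _ = _ := by
      simp only [← h2, Finset.mul_sum, Finset.sum_mul]
      rw [Finset.sum_comm]
      exact Finset.sum_congr rfl fun i _ => Finset.sum_congr rfl fun k _ => by ring

theorem IsQMF.sum_mul_star_waveletOp {m : Fin N → C(Circle, ℂ)} (hm : IsQMF m) (hN : 2 ≤ N) :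
    ∑ i, waveletOp hN (m i) * star (waveletOp hN (m i)) = 1 := by
  have hrange : ∀ F : Fin N → Lp ℂ 2 circleHaar,
      (∑ i, waveletOp hN (m i) * star (waveletOp hN (m i)))
        (∑ j, waveletOp hN (m j) (F j)) = ∑ j, waveletOp hN (m j) (F j) := by
    intro F
    rw [sum_apply]
    refine Finset.sum_congr rfl fun i _ => ?_
    change waveletOp hN (m i) (star (waveletOp hN (m i)) _) = _
    congr 1
    rw [map_sum, Finset.sum_eq_single i]
    · have h := hm.star_mul_waveletOp hN i i
      rw [if_pos rfl] at h
      exact congrArg (fun T : Lp ℂ 2 circleHaar →L[ℂ] Lp ℂ 2 circleHaar => T (F i)) h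
    · intro j _ hj
      have h := hm.star_mul_waveletOp hN i j
      rw [if_neg (Ne.symm hj)] at h
      exact congrArg (fun T : Lp ℂ 2 circleHaar →L[ℂ] Lp ℂ 2 circleHaar => T (F j)) h
    · simp
  have hdense := ContinuousMap.toLp_denseRange ℂ circleHaar ℂ (p := 2) (by simp)
  refine ContinuousLinearMap.ext fun x => ?_
  refine hdense.induction_on (p := fun x => (∑ i, waveletOp hN (m i) *
    star (waveletOp hN (m i))) x = (1 : Lp ℂ 2 circleHaar →L[ℂ] Lp ℂ 2 circleHaar) x) x
    (isClosed_eq (ContinuousLinearMap.continuous _) (ContinuousLinearMap.continuous _)) ?_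
  intro f
  obtain ⟨F, hF⟩ := hm.exists_decomposition (by omega) f
  have : ContinuousMap.toLp 2 circleHaar ℂ f =
      ∑ j, waveletOp hN (m j) (ContinuousMap.toLp 2 circleHaar ℂ (F j)) := by
    have h1 : ∀ j, waveletOp hN (m j) (ContinuousMap.toLp 2 circleHaar ℂ (F j)) =
        ContinuousMap.toLp 2 circleHaar ℂ
          (m j * (F j).comp ⟨fun z => z ^ N, continuous_pow N⟩) := by
      intro j
      apply Lp.ext
      have hq := (measurePreserving_circle_pow (show N ≠ 0 by omega)).quasiMeasurePreserving
      have h2 := hq.ae_eq_comp (ContinuousMap.coeFn_toLp (p := 2) (𝕜 := ℂ) circleHaar (F j))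
      filter_upwards [coeFn_waveletOp hN (m j) (ContinuousMap.toLp 2 circleHaar ℂ (F j)), h2,
        ContinuousMap.coeFn_toLp (p := 2) (𝕜 := ℂ) circleHaar
          (m j * (F j).comp ⟨fun z => z ^ N, continuous_pow N⟩)] with z h3 h4 h5
      rw [h3, h5]
      simp only [Function.comp_apply] at h4
      rw [h4]
      rfl
    simp only [h1]
    rw [← map_sum]
    congr 1
    ext z
    simp [hF z]
  rw [this, hrange]
  rfl

end QMF

/-- The wavelet representation `S_i f(z) = m_i(z) f(z^N)` on `L²` of the circle, associated to a
QMF system. -/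
noncomputable def waveletRep {N : ℕ} (hN : 2 ≤ N) (m : Fin N → C(Circle, ℂ)) (hm : IsQMF m) :
    CuntzRep N (Lp ℂ 2 circleHaar) where
  two_le := hN
  S i := waveletOp hN (m i)
  star_mul_mul i j := hm.star_mul_waveletOp hN i j
  sum_mul_star := hm.sum_mul_star_waveletOp hN

/-! A filter `a z^k` acts on the Fourier basis by `z^n ↦ a z^(k + N n)`. Along a cycle of monomial
filters these affine maps compose to `n ↦ σ + N^p n`, where `σ = ∑ N^j k_j`. If `σ = (N^p - 1) s`,
then `n = -s` is a fixed point, so `z^(-s)` is an eigenvector of `S_I` and lies in the range of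
every `S_I^n`. The projection of each cylinder of `I I I …` fixes it, hence so does the projection
of their intersection, which is an atom (`hasAtom_of_word_apply_eq_smul`).

Conversely, the adjoints `S_iᴴ` roughly divide frequencies by `N`, so they preserve the space of
trigonometric polynomials with frequencies in `[-M, M]` once `M` is large. An atom `ω` does not
annihilate every monomial. Applying the adjoints along `ω` to a surviving monomial gives vectors in
a finite-dimensional space whose norms decrease to a positive limit. A compactness argument on
vectors and shifted words together removes the loss of norm: it gives nonzero trigonometric
polynomials with `g_n(z) = m_{η_n}(z) g_{n+1}(z^N)` (`exists_seq_of_isAtom`).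

Let the width of a trigonometric polynomial be its highest frequency minus its lowest. Widths add
under products and are multiplied by `N` under `z ↦ z^N`, so the width of `g_n` at least halves at
each step and is eventually zero. From then on all `g_n` and all filters `m_{η_n}` are monomials
(`exists_forall_monomial`). The exponents satisfy `l_n = k_n + N l_{n+1}` and stay in `[-M, M]`, so
one value recurs, and the relation between two occurrences is the divisibility (`exists_cycle_dvd`).

Under the low-pass condition, `∑ |m_j(1)|² = N` is exhausted by `m_0`, so no filter has modulus one
at `1` and none is a unimodular monomial. -/

namespace ProjectionValuedMeasure

/-! ### Monotonicity and intersections for projection-valued measures -/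

variable {X : Type*} [MeasurableSpace X] {H : Type*} [NormedAddCommGroup H]
  [InnerProductSpace ℂ H] [CompleteSpace H]

theorem proj_union (P : ProjectionValuedMeasure X H) {A B : Set X} (hA : MeasurableSet A)
    (hB : MeasurableSet B) (hd : Disjoint A B) : P.proj (A ∪ B) = P.proj A + P.proj B := by
  ext x
  let f : ℕ → Set X := fun n => if n = 0 then A else if n = 1 then B else ∅
  have hf : ∀ n, MeasurableSet (f n) := by
    intro n
    simp only [f]
    split_ifs
    exacts [hA, hB, .empty]
  have hd' : Pairwise (Function.onFun Disjoint f) := by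
    intro i j hij
    rw [Function.onFun]
    simp only [f]
    split_ifs <;> first | omega | exact hd | simp [hd.symm]
  have hU : ⋃ n, f n = A ∪ B := by
    ext y
    rw [Set.mem_iUnion]
    constructor
    · rintro ⟨n, hn⟩
      simp only [f] at hn
      split_ifs at hn
      exacts [.inl hn, .inr hn, hn.elim]
    · rintro (hy | hy)
      exacts [⟨0, by simpa [f] using hy⟩, ⟨1, by simpa [f] using hy⟩]
  have h := P.hasSum_iUnion f hf hd' x
  have h2 : HasSum (fun n => P.proj (f n) x) (∑ n ∈ Finset.range 2, P.proj (f n) x) := by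
    refine hasSum_sum_of_ne_finset_zero fun n hn => ?_
    have h0 : n ≠ 0 := by rintro rfl; simp at hn
    have h1 : n ≠ 1 := by rintro rfl; simp at hn
    simp [f, h0, h1, P.proj_empty]
  have h3 := h.unique h2
  rw [hU] at h3
  simpa [Finset.sum_range_succ, f] using h3

theorem proj_diff (P : ProjectionValuedMeasure X H) {A B : Set X} (hA : MeasurableSet A)
    (hB : MeasurableSet B) (h : A ⊆ B) : P.proj (B \ A) = P.proj B - P.proj A := by
  rw [eq_sub_iff_add_eq, ← P.proj_union (hB.diff hA) hA Set.disjoint_sdiff_left,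
    Set.sdiff_union_of_subset h]

/-- The difference of the squared norms is `⟪P(B \ A) x, x⟫ = ‖P(B \ A) x‖² ≥ 0`. -/
theorem norm_proj_mono (P : ProjectionValuedMeasure X H) {A B : Set X} (hA : MeasurableSet A)
    (hB : MeasurableSet B) (h : A ⊆ B) (x : H) : ‖P.proj A x‖ ≤ ‖P.proj B x‖ := by
  have h1 := starProjection_inner_self (P.isStarProjection _ (hB.diff hA)) x
  rw [P.proj_diff hA hB h, sub_apply, inner_sub_left,
    starProjection_inner_self (P.isStarProjection _ hA),
    starProjection_inner_self (P.isStarProjection _ hB), ← Complex.ofReal_sub,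
    Complex.ofReal_inj] at h1
  exact (pow_le_pow_iff_left₀ (norm_nonneg _) (norm_nonneg _) two_ne_zero).1
    (by nlinarith [sq_nonneg ‖P.proj B x - P.proj A x‖])

/-- A vector fixed by the projections of countably many sets is fixed by that of the intersection. -/
theorem proj_iInter_apply_of_forall (P : ProjectionValuedMeasure X H) {C : ℕ → Set X}
    (hC : ∀ n, MeasurableSet (C n)) {x : H} (hx : ∀ n, P.proj (C n) x = x) :
    P.proj (⋂ n, C n) x = x := by
  -- Pass to complements: the vector is annihilated by each complement, hence by its disjointed
  -- part, hence by the union through countable additivity.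
  have hD : ∀ n, MeasurableSet (C n)ᶜ := fun n => (hC n).compl
  have hU := P.hasSum_iUnion (disjointed fun n => (C n)ᶜ) (fun n => .disjointed hD n)
    (disjoint_disjointed _) x
  have h0 : ∀ n, P.proj (disjointed (fun n => (C n)ᶜ) n) x = 0 := by
    intro n
    have h1 := P.norm_proj_mono (.disjointed hD n) (hD n) (disjointed_subset _ n) x
    have h2 : P.proj (C n)ᶜ x = 0 := by
      rw [P.proj_compl (hC n), sub_apply, one_apply_eq_self, hx, sub_self]
    rw [h2, norm_zero] at h1
    exact norm_le_zero_iff.1 h1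
  simp only [h0] at hU
  have h3 := hU.unique hasSum_zero
  rw [iUnion_disjointed, ← Set.compl_iInter, P.proj_compl (.iInter hC), sub_apply,
    one_apply_eq_self, sub_eq_zero] at h3
  exact h3.symm

end ProjectionValuedMeasure

/-! ### Prefixes of infinite words and their cylinders -/

/-- The finite word formed by the first `n` letters of an infinite word. -/
def prefixWord {α : Type*} (ω : ℕ → α) (n : ℕ) : List α := (List.range n).map ω

theorem prefixWord_add {α : Type*} (ω : ℕ → α) (n j : ℕ) :
    prefixWord ω (n + j) = prefixWord ω n ++ prefixWord (fun k => ω (n + k)) j := by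
  rw [prefixWord, List.range_add, List.map_append, List.map_map]
  rfl

theorem mem_wordCylinder_prefixWord {N : ℕ} {ω η : ℕ → Fin N} {n : ℕ} :
    η ∈ wordCylinder (prefixWord ω n) ↔ ∀ k < n, η k = ω k := by
  simp [wordCylinder, prefixWord]

theorem antitone_wordCylinder_prefixWord {N : ℕ} (ω : ℕ → Fin N) :
    Antitone fun n => wordCylinder (prefixWord ω n) := fun a b h η hη => by
  rw [mem_wordCylinder_prefixWord] at hη ⊢
  exact fun k hk => hη k (by omega)

theorem iInter_wordCylinder_prefixWord {N : ℕ} (ω : ℕ → Fin N) :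
    ⋂ n, wordCylinder (prefixWord ω n) = {ω} := by
  ext η
  simp only [Set.mem_iInter, mem_wordCylinder_prefixWord, Set.mem_singleton_iff]
  exact ⟨fun h => funext fun k => h (k + 1) k (by omega), fun h _ _ _ => h ▸ rfl⟩

/-! ### Atoms in a general Cuntz representation -/

namespace CuntzRep

variable {N : ℕ} {H : Type*} [NormedAddCommGroup H] [InnerProductSpace ℂ H] [CompleteSpace H]

theorem word_append (R : CuntzRep N H) (I J : List (Fin N)) :
    R.word (I ++ J) = R.word I * R.word J := by
  simp [word]

theorem norm_star_S_le (R : CuntzRep N H) (i : Fin N) (x : H) : ‖star (R.S i) x‖ ≤ ‖x‖ := by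
  refine (pow_le_pow_iff_left₀ (norm_nonneg _) (norm_nonneg _) two_ne_zero).1 ?_
  rw [← R.sum_norm_sq x]
  exact Finset.single_le_sum (f := fun i => ‖star (R.S i) x‖ ^ 2) (fun _ _ => by positivity)
    (Finset.mem_univ i)

/-- Since `S_i` is an isometry, the projection `S_i S_iᴴ` preserves the norm of `x`, and a
projection that does so fixes `x` by Pythagoras. -/
theorem S_star_S_apply_of_norm_eq (R : CuntzRep N H) {i : Fin N} {x : H}
    (h : ‖star (R.S i) x‖ = ‖x‖) : R.S i (star (R.S i) x) = x := by
  have hP : IsStarProjection (R.S i * star (R.S i)) := by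
    simpa [word] using R.isStarProjection_word [i]
  have h1 : ‖(R.S i * star (R.S i)) x‖ = ‖x‖ := by
    rw [← h]
    simpa [word] using R.norm_word [i] (star (R.S i) x)
  have h2 := norm_sq_one_sub hP x
  rw [h1, sub_self, sq_eq_zero_iff, norm_eq_zero, sub_apply, one_apply_eq_self,
    sub_eq_zero] at h2
  exact h2.symm

theorem norm_proj_wordCylinder (R : CuntzRep N H) (I : List (Fin N)) (x : H) :
    ‖R.pvm.proj (wordCylinder I) x‖ = ‖star (R.word I) x‖ := by
  rw [pvm_wordCylinder]
  exact R.norm_word I _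

/-- A lower bound uniform in `n`: along an atom that does not annihilate `x`, the norms cannot decay
to zero. -/
theorem norm_proj_singleton_le (R : CuntzRep N H) (ω : ℕ → Fin N) (n : ℕ) (x : H) :
    ‖R.pvm.proj {ω} x‖ ≤ ‖star (R.word (prefixWord ω n)) x‖ := by
  rw [← norm_proj_wordCylinder]
  refine R.pvm.norm_proj_mono (measurableSet_singleton _) (measurableSet_wordCylinder _) ?_ x
  rw [Set.singleton_subset_iff, mem_wordCylinder_prefixWord]
  exact fun _ _ => rfl

theorem proj_wordCylinder_apply_word (R : CuntzRep N H) (I : List (Fin N)) (x : H) :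
    R.pvm.proj (wordCylinder I) (R.word I x) = R.word I x := by
  rw [pvm_wordCylinder]
  change (R.word I * star (R.word I) * R.word I) x = _
  rw [mul_assoc, star_word_mul_word, mul_one]

theorem star_word_prefixWord_add (R : CuntzRep N H) (ω : ℕ → Fin N) (n j : ℕ) (x : H) :
    star (R.word (prefixWord ω (n + j))) x =
      star (R.word (prefixWord (fun k => ω (n + k)) j)) (star (R.word (prefixWord ω n)) x) := by
  rw [prefixWord_add, word_append, star_mul]
  rfl

theorem star_word_prefixWord_succ (R : CuntzRep N H) (ω : ℕ → Fin N) (n : ℕ) (x : H) :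
    star (R.word (prefixWord ω (n + 1))) x =
      star (R.S (ω n)) (star (R.word (prefixWord ω n)) x) := by
  rw [star_word_prefixWord_add]
  simp [prefixWord, word]

/-- A nonzero eigenvector of `S_I`, `I` nonempty, produces the atom `I I I …`. -/
theorem hasAtom_of_word_apply_eq_smul (R : CuntzRep N H) {p : ℕ} (hp : 1 ≤ p) (i : Fin p → Fin N)
    {x : H} (hx : x ≠ 0) {c : ℂ} (hc : c ≠ 0) (h : R.word (List.ofFn i) x = c • x) :
    R.HasAtom := by
  let ω : ℕ → Fin N := fun n => i ⟨n % p, Nat.mod_lt _ hp⟩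
  have hω : ∀ n, (fun k => ω (p * n + k)) = ω := fun n => by
    funext k
    simp [ω]
  have hpre : prefixWord ω p = List.ofFn i := by
    refine List.ext_getElem (by simp [prefixWord]) fun n h1 h2 => ?_
    have hn : n < p := by simpa [prefixWord] using h1
    simp [prefixWord, ω, Nat.mod_eq_of_lt hn]
  have hword : ∀ n, R.word (prefixWord ω (p * n)) x = c ^ n • x := by
    intro n
    induction n with
    | zero => simp [prefixWord, word]
    | succ n ih =>
      rw [Nat.mul_succ, prefixWord_add, hω, word_append, hpre]
      change R.word _ (R.word _ x) = _
      rw [h, map_smul, ih, smul_smul, pow_succ']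
  refine ⟨ω, fun h0 => hx ?_⟩
  rw [← iInter_wordCylinder_prefixWord] at h0
  have hfix : ∀ n, R.pvm.proj (wordCylinder (prefixWord ω (p * n))) x = x := by
    intro n
    have h1 := R.proj_wordCylinder_apply_word (prefixWord ω (p * n)) x
    rw [hword, map_smul] at h1
    exact smul_right_injective _ (pow_ne_zero n hc) h1
  -- The cylinders decrease, so the prefixes made of full periods determine the intersection.
  have h2 : ⋂ n, wordCylinder (prefixWord ω n) = ⋂ n, wordCylinder (prefixWord ω (p * n)) := by
    refine Set.Subset.antisymm (Set.subset_iInter fun n => Set.iInter_subset _ _)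
      (Set.subset_iInter fun n => (Set.iInter_subset _ n).trans
        (antitone_wordCylinder_prefixWord ω (Nat.le_mul_of_pos_left n hp)))
  rw [h2] at h0
  rw [← R.pvm.proj_iInter_apply_of_forall (fun n => measurableSet_wordCylinder _) hfix, h0]
  rfl

/-- If a finite-dimensional subspace is invariant under the operators `S_iᴴ` and is not orthogonal
to some atom, then it contains a sequence of vectors of constant nonzero norm with
`x_n = S_{i_n} x_{n + 1}`. -/
theorem exists_seq_of_isAtom (R : CuntzRep N H) (V : Submodule ℂ H) [FiniteDimensional ℂ V]
    (hV : ∀ i, ∀ x ∈ V, star (R.S i) x ∈ V) {ω : ℕ → Fin N} {x : H} (hxV : x ∈ V)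
    (hx : R.pvm.proj {ω} x ≠ 0) :
    ∃ (η : ℕ → Fin N) (y : ℕ → H), ∀ n, y n ∈ V ∧ y n ≠ 0 ∧ y n = R.S (η n) (y (n + 1)) := by
  let v : ℕ → H := fun n => star (R.word (prefixWord ω n)) x
  have hvsucc : ∀ n, v (n + 1) = star (R.S (ω n)) (v n) :=
    fun n => R.star_word_prefixWord_succ ω n x
  have hv0 : v 0 = x := by simp [v, prefixWord, word]
  have hvV : ∀ n, v n ∈ V := by
    intro n
    induction n with
    | zero => rwa [hv0]
    | succ n ih => rw [hvsucc]; exact hV _ _ ih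
  have hanti : Antitone fun n => ‖v n‖ :=
    antitone_nat_of_succ_le fun n => by rw [hvsucc]; exact R.norm_star_S_le _ _
  obtain ⟨c, hc⟩ : ∃ c, Tendsto (fun n => ‖v n‖) atTop (𝓝 c) :=
    ⟨_, tendsto_atTop_ciInf hanti ⟨0, by rintro _ ⟨n, rfl⟩; exact norm_nonneg _⟩⟩
  have hcpos : 0 < c := lt_of_lt_of_le (norm_pos_iff.2 hx)
    (ge_of_tendsto' hc fun n => R.norm_proj_singleton_le ω n x)
  -- A limit along a free ultrafilter takes the place of a diagonal subsequence: it fixes every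
  -- letter of the shifted words `ω (n + ·)`, because the alphabet is finite, and the limit of the
  -- `v n` at the same time.
  let u : Ultrafilter ℕ := hyperfilter ℕ
  have hu : (u : Filter ℕ) ≤ atTop := Nat.hyperfilter_le_atTop
  obtain ⟨η, hη⟩ : ∃ η : ℕ → Fin N, ∀ k, ∀ᶠ n in (u : Filter ℕ), ω (n + k) = η k := by
    have h1 : ∀ k, ∃ a : Fin N, ∀ᶠ n in (u : Filter ℕ), ω (n + k) = a := fun k =>
      (Ultrafilter.eventually_exists_iff (f := u) (P := fun a n => ω (n + k) = a)).1
        (Eventually.of_forall fun n => ⟨_, rfl⟩)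
    exact Classical.axiomOfChoice h1
  obtain ⟨y, hy⟩ : ∃ y : H, y ∈ V ∧ Tendsto v u (𝓝 y) := by
    -- Finite dimension of `V` enters here: the `v n` stay in a compact ball, so they converge in
    -- norm along `u`.
    have hK := isCompact_closedBall (0 : V) ‖x‖
    let w : ℕ → V := fun n => ⟨v n, hvV n⟩
    obtain ⟨y, -, hy⟩ := hK.ultrafilter_le_nhds (u.map w) (by
      rw [le_principal_iff, Ultrafilter.mem_coe, Ultrafilter.mem_map]
      refine Filter.univ_mem' fun n => ?_
      change dist (w n) 0 ≤ ‖x‖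
      rw [dist_zero_right]
      have := hanti (Nat.zero_le n)
      simp only [hv0] at this
      exact this)
    exact ⟨y, y.2, (continuous_subtype_val.tendsto y).comp hy⟩
  have hpre : ∀ j, ∀ᶠ n in (u : Filter ℕ),
      prefixWord (fun k => ω (n + k)) j = prefixWord η j := by
    intro j
    have : ∀ᶠ n in (u : Filter ℕ), ∀ k ∈ Finset.range j, ω (n + k) = η k :=
      (Finset.eventually_all _).2 fun k _ => hη k
    filter_upwards [this] with n hn
    exact List.map_congr_left fun k hk => hn k (by simpa using hk)
  let z : ℕ → H := fun j => star (R.word (prefixWord η j)) y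
  have hzsucc : ∀ n, z (n + 1) = star (R.S (η n)) (z n) :=
    fun n => R.star_word_prefixWord_succ η n y
  -- For `u`-almost all `n`, the first `j` letters of `η` are those of `ω` after position `n`, so
  -- applying their adjoint to `v n` gives `v (n + j)`. Its norm tends to `c` whatever `j` is.
  have hznorm : ∀ j, ‖z j‖ = c := by
    intro j
    have h1 : Tendsto (fun n => ‖star (R.word (prefixWord η j)) (v n)‖) u (𝓝 ‖z j‖) :=
      (((star (R.word (prefixWord η j))).continuous.norm).tendsto y).comp hy.2
    have h2 : Tendsto (fun n => ‖v (n + j)‖) u (𝓝 c) :=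
      (hc.comp (tendsto_add_atTop_nat j)).mono_left hu
    refine tendsto_nhds_unique (h1.congr' ?_) h2
    filter_upwards [hpre j] with n hn
    rw [← hn, ← star_word_prefixWord_add]
  refine ⟨η, z, fun n => ⟨?_, ?_, ?_⟩⟩
  · induction n with
    | zero => simpa [z, prefixWord, word] using hy.1
    | succ n ih => rw [hzsucc]; exact hV _ _ ih
  · rw [← norm_pos_iff, hznorm]
    exact hcpos
  · rw [hzsucc]
    -- The norms are constant, so nothing is lost in applying the adjoint and `S_iᴴ` can be inverted
    -- by `S_i`.
    exact (R.S_star_S_apply_of_norm_eq (by rw [← hzsucc, hznorm, hznorm])).symm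

end CuntzRep

/-! ### The Fourier basis of the circle with its Haar measure -/

/-- The monomial `z ↦ z^n` on the circle. -/
noncomputable def circleMonomial (n : ℤ) : C(Circle, ℂ) :=
  ⟨fun z => ((z ^ n : Circle) : ℂ), continuous_subtype_val.comp (continuous_zpow n)⟩

theorem circleMonomial_apply (n : ℤ) (z : Circle) : circleMonomial n z = (z : ℂ) ^ n :=
  Circle.coe_zpow z n

/-- The monomial `z^n` as an element of `L²` of the circle. -/
noncomputable def circleFourier (n : ℤ) : Lp ℂ 2 circleHaar :=
  ContinuousMap.toLp 2 circleHaar ℂ (circleMonomial n)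

/-- Rotation by a point `w` with `w^n = -1` changes the sign of the integrand and preserves the
measure. -/
theorem integral_circleMonomial {n : ℤ} (hn : n ≠ 0) :
    ∫ z, circleMonomial n z ∂circleHaar = 0 := by
  obtain ⟨w, hw⟩ : ∃ w : Circle, circleMonomial n w = -1 := by
    obtain ⟨w, hw⟩ := circle_pow_surjective (Int.natAbs_ne_zero.2 hn) (Circle.exp Real.pi)
    have hw' : (w : ℂ) ^ n.natAbs = -1 := by
      have := congrArg (fun z : Circle => (z : ℂ)) hw
      simpa [Circle.coe_exp, Complex.exp_pi_mul_I] using this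
    refine ⟨w, ?_⟩
    rw [circleMonomial_apply]
    obtain h | h := Int.natAbs_eq n
    · rw [h, zpow_natCast, hw']
    · rw [h, zpow_neg, zpow_natCast, hw']
      norm_num
  have h1 := integral_mul_left_eq_self (μ := circleHaar) (fun z => circleMonomial n z) w
  have h2 : ∀ z, circleMonomial n (w * z) = -circleMonomial n z := by
    intro z
    rw [circleMonomial_apply, Circle.coe_mul, mul_zpow, ← circleMonomial_apply,
      ← circleMonomial_apply, hw, neg_one_mul]
  simp only [h2, integral_neg] at h1
  exact self_eq_neg.1 h1.symm

theorem orthonormal_circleFourier : Orthonormal ℂ circleFourier := by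
  rw [orthonormal_iff_ite]
  intro a b
  have h1 : inner ℂ (circleFourier a) (circleFourier b) =
      ∫ z, circleMonomial (b - a) z ∂circleHaar := by
    rw [L2.inner_def]
    refine integral_congr_ae ?_
    filter_upwards [ContinuousMap.coeFn_toLp (p := 2) (𝕜 := ℂ) circleHaar (circleMonomial a),
      ContinuousMap.coeFn_toLp (p := 2) (𝕜 := ℂ) circleHaar (circleMonomial b)] with z ha hb
    rw [circleFourier, circleFourier, ha, hb, RCLike.inner_apply, circleMonomial_apply,
      circleMonomial_apply, circleMonomial_apply, zpow_sub₀ (Circle.coe_ne_zero z), map_zpow₀,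
      ← Circle.coe_inv_eq_conj, Circle.coe_inv, inv_zpow, div_eq_mul_inv]
  rw [h1]
  split_ifs with h
  · simp [h, circleMonomial_apply]
  · exact integral_circleMonomial (sub_ne_zero.2 (Ne.symm h))

/-- The star subalgebra of the trigonometric polynomials. -/
noncomputable def circleMonomialSubalgebra : StarSubalgebra ℂ C(Circle, ℂ) where
  toSubalgebra := Algebra.adjoin ℂ (Set.range circleMonomial)
  star_mem' := by
    change Algebra.adjoin ℂ (Set.range circleMonomial) ≤
      star (Algebra.adjoin ℂ (Set.range circleMonomial))
    refine Algebra.adjoin_le ?_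
    rintro _ ⟨n, rfl⟩
    refine Algebra.subset_adjoin ⟨-n, ContinuousMap.ext fun z => ?_⟩
    rw [ContinuousMap.star_apply, circleMonomial_apply, circleMonomial_apply, Complex.star_def,
      map_zpow₀, ← Circle.coe_inv_eq_conj, Circle.coe_inv, inv_zpow, zpow_neg]

theorem toSubmodule_circleMonomialSubalgebra :
    Subalgebra.toSubmodule circleMonomialSubalgebra.toSubalgebra =
      Submodule.span ℂ (Set.range circleMonomial) := by
  refine Algebra.adjoin_eq_span_of_subset ℂ (Set.Subset.trans ?_ Submodule.subset_span)
  intro f hf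
  refine Submonoid.closure_induction (fun _ => id) ⟨0, ?_⟩ ?_ hf
  · ext z
    simp [circleMonomial_apply]
  · rintro _ _ _ _ ⟨a, rfl⟩ ⟨b, rfl⟩
    refine ⟨a + b, ContinuousMap.ext fun z => ?_⟩
    rw [ContinuousMap.mul_apply, circleMonomial_apply, circleMonomial_apply,
      circleMonomial_apply, zpow_add₀ (Circle.coe_ne_zero z)]

/-- Stone–Weierstrass; the monomial `z` alone separates points. -/
theorem span_circleMonomial_closure_eq_top :
    (Submodule.span ℂ (Set.range circleMonomial)).topologicalClosure = ⊤ := by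
  have hsep : circleMonomialSubalgebra.SeparatesPoints := by
    intro z w hzw
    refine ⟨_, ⟨circleMonomial 1, Algebra.subset_adjoin ⟨1, rfl⟩, rfl⟩, ?_⟩
    beta_reduce
    rw [circleMonomial_apply, circleMonomial_apply, zpow_one, zpow_one]
    exact fun h => hzw (Circle.ext h)
  rw [← toSubmodule_circleMonomialSubalgebra]
  exact congrArg (Subalgebra.toSubmodule <| StarSubalgebra.toSubalgebra ·)
    (ContinuousMap.starSubalgebra_topologicalClosure_eq_top_of_separatesPoints _ hsep)

theorem span_circleFourier_closure_eq_top :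
    (Submodule.span ℂ (Set.range circleFourier)).topologicalClosure = ⊤ := by
  have h := (ContinuousMap.toLp_denseRange ℂ circleHaar ℂ (p := 2)
    (by simp)).topologicalClosure_map_submodule span_circleMonomial_closure_eq_top
  erw [Submodule.map_span, ← Set.range_comp] at h
  exact h

/-- The monomials form a Hilbert basis of `L²` of the circle. -/
noncomputable def circleFourierBasis : HilbertBasis ℤ ℂ (Lp ℂ 2 circleHaar) :=
  HilbertBasis.mk orthonormal_circleFourier span_circleFourier_closure_eq_top.ge

theorem circleFourierBasis_apply (n : ℤ) : circleFourierBasis n = circleFourier n := by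
  rw [circleFourierBasis, HilbertBasis.coe_mk]

/-! ### Trigonometric polynomials of bounded frequency and the wavelet operators -/

/-- The trigonometric polynomials with frequencies in `[-M, M]`, as a subspace of `L²`. -/
noncomputable def trigSpace (M : ℕ) : Submodule ℂ (Lp ℂ 2 circleHaar) :=
  Submodule.span ℂ (circleFourier '' Set.Icc (-M : ℤ) M)

instance instFiniteDimensionalTrigSpace (M : ℕ) : FiniteDimensional ℂ (trigSpace M) :=
  FiniteDimensional.span_of_finite ℂ ((Set.finite_Icc _ _).image _)

/-- Membership expressed through Fourier coefficients allows an adjoint to be moved onto the basis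
vectors, where the wavelet operators are explicit. -/
theorem mem_trigSpace_iff {M : ℕ} {x : Lp ℂ 2 circleHaar} :
    x ∈ trigSpace M ↔ ∀ n : ℤ, n ∉ Set.Icc (-M : ℤ) M → inner ℂ (circleFourier n) x = 0 := by
  constructor
  · intro hx n hn
    induction hx using Submodule.span_induction with
    | mem x hx =>
      obtain ⟨k, hk, rfl⟩ := hx
      rw [orthonormal_iff_ite.1 orthonormal_circleFourier, if_neg]
      rintro rfl
      exact hn hk
    | zero => exact inner_zero_right _
    | add x y _ _ hx hy => rw [inner_add_right, hx, hy, add_zero]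
    | smul c x _ hx => rw [inner_smul_right, hx, mul_zero]
  · intro h
    have h1 := circleFourierBasis.hasSum_repr x
    simp only [HilbertBasis.repr_apply_apply, circleFourierBasis_apply] at h1
    have h2 := hasSum_sum_of_ne_finset_zero (L := .unconditional ℤ)
      (f := fun n => inner ℂ (circleFourier n) x • circleFourier n) (s := Finset.Icc (-M : ℤ) M)
      fun n hn => by rw [h n (by simpa using hn), zero_smul]
    rw [h1.unique h2]
    refine Submodule.sum_mem _ fun n hn => Submodule.smul_mem _ _ ?_
    exact Submodule.subset_span ⟨n, by simpa using hn, rfl⟩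

/-- Continuous representatives turn identities in `L²` into identities at every point of the circle.
-/
theorem exists_isTrigPolynomial_of_mem_trigSpace {M : ℕ} {x : Lp ℂ 2 circleHaar}
    (hx : x ∈ trigSpace M) :
    ∃ f : C(Circle, ℂ), IsTrigPolynomial f ∧ ContinuousMap.toLp 2 circleHaar ℂ f = x := by
  obtain ⟨c, -, rfl⟩ := (Finsupp.mem_span_image_iff_linearCombination ℂ).1 hx
  refine ⟨Finsupp.linearCombination ℂ circleMonomial c, ⟨c, fun z => ?_⟩, ?_⟩
  · simp [Finsupp.linearCombination_apply, Finsupp.sum, circleMonomial_apply]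
  · rw [Finsupp.linearCombination_apply, Finsupp.linearCombination_apply, Finsupp.sum,
      Finsupp.sum, map_sum]
    simp only [map_smul]
    rfl

theorem waveletOp_toLp {N : ℕ} (hN : 2 ≤ N) (m f : C(Circle, ℂ)) :
    waveletOp hN m (ContinuousMap.toLp 2 circleHaar ℂ f) =
      ContinuousMap.toLp 2 circleHaar ℂ (m * f.comp ⟨fun z => z ^ N, continuous_pow N⟩) := by
  apply Lp.ext
  have hq := (measurePreserving_circle_pow (show N ≠ 0 by omega)).quasiMeasurePreserving
  filter_upwards [coeFn_waveletOp hN m (ContinuousMap.toLp 2 circleHaar ℂ f),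
    hq.ae_eq_comp (ContinuousMap.coeFn_toLp (p := 2) (𝕜 := ℂ) circleHaar f),
    ContinuousMap.coeFn_toLp (p := 2) (𝕜 := ℂ) circleHaar
      (m * f.comp ⟨fun z => z ^ N, continuous_pow N⟩)] with z h1 h2 h3
  rw [h1, h3]
  simp only [Function.comp_apply] at h2
  rw [h2]
  rfl

theorem waveletOp_circleFourier_of_monomial {N : ℕ} (hN : 2 ≤ N) {m : C(Circle, ℂ)} {a : ℂ}
    {k : ℤ} (hm : ∀ z : Circle, m z = a * (z : ℂ) ^ k) (n : ℤ) :
    waveletOp hN m (circleFourier n) = a • circleFourier (k + N * n) := by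
  rw [circleFourier, waveletOp_toLp, circleFourier, ← map_smul]
  congr 1
  ext z
  simp only [ContinuousMap.mul_apply, ContinuousMap.comp_apply, ContinuousMap.coe_mk,
    ContinuousMap.smul_apply, circleMonomial_apply, smul_eq_mul, hm, Circle.coe_pow]
  rw [zpow_add₀ (Circle.coe_ne_zero z), zpow_mul, zpow_natCast, mul_assoc]

theorem waveletOp_circleFourier {N : ℕ} (hN : 2 ≤ N) {m : C(Circle, ℂ)} {c : ℤ →₀ ℂ}
    (hc : ∀ z : Circle, m z = c.sum fun n a => a * (z : ℂ) ^ n) (l : ℤ) :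
    waveletOp hN m (circleFourier l) = ∑ k ∈ c.support, c k • circleFourier (k + N * l) := by
  rw [circleFourier, waveletOp_toLp]
  simp only [circleFourier, ← map_smul, ← map_sum]
  congr 1
  ext z
  simp only [ContinuousMap.mul_apply, ContinuousMap.comp_apply, ContinuousMap.coe_mk,
    ContinuousMap.sum_apply, ContinuousMap.smul_apply, circleMonomial_apply, smul_eq_mul, hc,
    Circle.coe_pow, Finsupp.sum, Finset.sum_mul]
  refine Finset.sum_congr rfl fun k _ => ?_
  rw [zpow_add₀ (Circle.coe_ne_zero z), zpow_mul, zpow_natCast, mul_assoc]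

/-- The adjoints of the wavelet operators with trigonometric filters do not increase frequencies
beyond those of the filters. -/
theorem exists_forall_star_waveletOp_mem_trigSpace {N : ℕ} (hN : 2 ≤ N) {ι : Type*} [Fintype ι]
    {m : ι → C(Circle, ℂ)} (hm : ∀ i, IsTrigPolynomial (m i)) :
    ∃ K : ℕ, ∀ M, K ≤ M → ∀ i, ∀ x ∈ trigSpace M, star (waveletOp hN (m i)) x ∈ trigSpace M := by
  choose c hc using hm
  -- A crude constant that bounds the absolute value of every frequency of every filter.
  refine ⟨∑ i, ∑ k ∈ (c i).support, k.natAbs, fun M hM i x hx => ?_⟩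
  rw [mem_trigSpace_iff] at hx ⊢
  intro l hl
  rw [ContinuousLinearMap.star_eq_adjoint, ContinuousLinearMap.adjoint_inner_right,
    waveletOp_circleFourier hN (hc i), sum_inner]
  refine Finset.sum_eq_zero fun k hk => ?_
  rw [inner_smul_left, hx, mul_zero]
  have h1 : k.natAbs ≤ M := by
    have h2 := Finset.single_le_sum (f := Int.natAbs) (fun _ _ => Nat.zero_le _) hk
    have h3 := Finset.single_le_sum (f := fun i => ∑ k ∈ (c i).support, k.natAbs)
      (fun _ _ => Nat.zero_le _) (Finset.mem_univ i)
    omega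
  -- If `|l| > M` and `|k| ≤ M`, then `|k + N l| ≥ 2 |l| - M > M`.
  have hN' : (2 : ℤ) ≤ N := by exact_mod_cast hN
  rw [Set.mem_Icc, not_and_or] at hl ⊢
  rcases hl with hl | hl
  · left
    have : (N : ℤ) * l ≤ 2 * l := by nlinarith
    omega
  · right
    have : 2 * l ≤ (N : ℤ) * l := by nlinarith
    omega

/-! ### The width of a trigonometric polynomial -/

/-- `f(z) = z^a p(z)` on the circle, for a polynomial `p` of degree `d` with nonzero constant
coefficient: the trigonometric polynomial `f` is nonzero and its frequencies span an interval of
length `d`. -/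
def HasWidth (f : Circle → ℂ) (d : ℕ) : Prop :=
  ∃ (a : ℤ) (p : Polynomial ℂ), p.coeff 0 ≠ 0 ∧ p.natDegree = d ∧
    ∀ z : Circle, f z = (z : ℂ) ^ a * p.eval (z : ℂ)

theorem infinite_range_circle_coe : (Set.range fun z : Circle => (z : ℂ)).Infinite := by
  have : Infinite Circle := by
    refine Set.infinite_univ_iff.1 ?_
    have h1 : Set.InjOn Circle.exp (Set.Ico 0 Real.pi) :=
      Circle.exp_injOn_Ico (by linarith [Real.pi_pos])
    exact ((Set.infinite_image_iff h1).2 (Set.Ico_infinite Real.pi_pos)).mono (Set.subset_univ _)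
  exact Set.infinite_range_of_injective fun _ _ h => Circle.ext h

theorem polynomial_eq_of_eval_circle {p q : Polynomial ℂ}
    (h : ∀ z : Circle, p.eval (z : ℂ) = q.eval (z : ℂ)) : p = q :=
  Polynomial.eq_of_infinite_eval_eq p q (infinite_range_circle_coe.mono (by
    rintro _ ⟨z, rfl⟩
    exact h z))

/-- Otherwise one polynomial would be the other times a positive power of `X`, against its nonzero
constant coefficient. This makes widths and exponents well defined. -/
theorem eq_of_zpow_mul_eval_eq {a b : ℤ} {p q : Polynomial ℂ} (hp : p.coeff 0 ≠ 0)
    (hq : q.coeff 0 ≠ 0)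
    (h : ∀ z : Circle, (z : ℂ) ^ a * p.eval (z : ℂ) = (z : ℂ) ^ b * q.eval (z : ℂ)) :
    a = b ∧ p = q := by
  wlog hab : a ≤ b generalizing a b p q
  · obtain ⟨h1, h2⟩ := this hq hp (fun z => (h z).symm) (by omega)
    exact ⟨h1.symm, h2.symm⟩
  obtain ⟨n, rfl⟩ : ∃ n : ℕ, b = a + n := ⟨(b - a).toNat, by omega⟩
  have h1 : p = Polynomial.X ^ n * q := polynomial_eq_of_eval_circle fun z => by
    have h2 := h z
    rw [zpow_add₀ (Circle.coe_ne_zero z), mul_assoc] at h2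
    simpa using mul_left_cancel₀ (zpow_ne_zero a (Circle.coe_ne_zero z)) h2
  cases n with
  | zero => exact ⟨by simp, by simpa using h1⟩
  | succ n =>
    refine absurd ?_ hp
    rw [h1, pow_succ', mul_assoc]
    simp

namespace HasWidth

theorem unique {f : Circle → ℂ} {d e : ℕ} (hd : HasWidth f d) (he : HasWidth f e) : d = e := by
  obtain ⟨a, p, hp, rfl, hf⟩ := hd
  obtain ⟨b, q, hq, rfl, hg⟩ := he
  rw [(eq_of_zpow_mul_eval_eq hp hq fun z => by rw [← hf, ← hg]).2]

theorem mul {f g : Circle → ℂ} {d e : ℕ} (hf : HasWidth f d) (hg : HasWidth g e) :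
    HasWidth (fun z => f z * g z) (d + e) := by
  obtain ⟨a, p, hp, rfl, hf⟩ := hf
  obtain ⟨b, q, hq, rfl, hg⟩ := hg
  have hp0 : p ≠ 0 := by rintro rfl; simp at hp
  have hq0 : q ≠ 0 := by rintro rfl; simp at hq
  refine ⟨a + b, p * q, ?_, Polynomial.natDegree_mul hp0 hq0, fun z => ?_⟩
  · rw [Polynomial.mul_coeff_zero]
    exact mul_ne_zero hp hq
  · beta_reduce
    rw [hf, hg, zpow_add₀ (Circle.coe_ne_zero z), Polynomial.eval_mul]
    ring

theorem comp_pow {f : Circle → ℂ} {d : ℕ} (hf : HasWidth f d) {N : ℕ} (hN : N ≠ 0) :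
    HasWidth (fun z => f (z ^ N)) (d * N) := by
  obtain ⟨a, p, hp, rfl, hf⟩ := hf
  refine ⟨N * a, Polynomial.expand ℂ N p, ?_, Polynomial.natDegree_expand N p, fun z => ?_⟩
  · rw [Polynomial.coeff_expand (Nat.pos_of_ne_zero hN)]
    simpa using hp
  · beta_reduce
    rw [hf, Polynomial.expand_eval, Circle.coe_pow, zpow_mul, zpow_natCast]

theorem eq_monomial {f : Circle → ℂ} (hf : HasWidth f 0) :
    ∃ (c : ℂ) (k : ℤ), c ≠ 0 ∧ ∀ z : Circle, f z = c * (z : ℂ) ^ k := by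
  obtain ⟨a, p, hp, hd, hf⟩ := hf
  refine ⟨p.coeff 0, a, hp, fun z => ?_⟩
  rw [hf, Polynomial.eq_C_of_natDegree_eq_zero hd]
  simp [mul_comm]

end HasWidth

/-- A nonzero trigonometric polynomial has a width. -/
theorem IsTrigPolynomial.exists_hasWidth {f : C(Circle, ℂ)} (hf : IsTrigPolynomial f)
    (h0 : f ≠ 0) : ∃ d, HasWidth f d := by
  obtain ⟨c, hc⟩ := hf
  -- Multiplication by `z^A` clears the negative frequencies.
  obtain ⟨A, hA⟩ : ∃ A : ℕ, ∀ n ∈ c.support, 0 ≤ n + A :=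
    ⟨∑ n ∈ c.support, n.natAbs, fun n hn => by
      have := Finset.single_le_sum (f := Int.natAbs) (fun _ _ => Nat.zero_le _) hn
      omega⟩
  let p : Polynomial ℂ := ∑ n ∈ c.support, Polynomial.monomial (n + A).toNat (c n)
  have hp : ∀ z : Circle, f z = (z : ℂ) ^ (-A : ℤ) * p.eval (z : ℂ) := by
    intro z
    rw [hc, Finsupp.sum, Polynomial.eval_finsetSum, Finset.mul_sum]
    refine Finset.sum_congr rfl fun n hn => ?_
    rw [Polynomial.eval_monomial, ← zpow_natCast, Int.toNat_of_nonneg (hA n hn), mul_left_comm,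
      ← zpow_add₀ (Circle.coe_ne_zero z)]
    congr 2
    omega
  have hp0 : p ≠ 0 := by
    intro h
    refine h0 (ContinuousMap.ext fun z => ?_)
    simp [hp, h]
  -- Splitting off the full power of `X` leaves a nonzero constant coefficient.
  obtain ⟨q, hq, hq'⟩ := Polynomial.exists_eq_pow_rootMultiplicity_mul_and_not_dvd p hp0 0
  rw [Polynomial.C_0, sub_zero] at hq hq'
  set r := p.rootMultiplicity 0
  refine ⟨q.natDegree, -A + r, q, ?_, rfl, fun z => ?_⟩
  · rwa [Ne, ← Polynomial.X_dvd_iff]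
  · rw [hp, hq, zpow_add₀ (Circle.coe_ne_zero z)]
    simp [mul_assoc]

/-! ### The modulus of QMF filters -/

theorem IsQMF.ne_zero {N : ℕ} {m : Fin N → C(Circle, ℂ)} (hm : IsQMF m) (i : Fin N) :
    m i ≠ 0 := by
  intro h
  simpa [h] using hm i i 1

/-- A monomial has constant modulus on the circle, and the average of `|m_i|²` over a fibre is `1`.
-/
theorem IsQMF.norm_eq_one_of_monomial {N : ℕ} {m : Fin N → C(Circle, ℂ)} (hm : IsQMF m)
    (hN : N ≠ 0) {i : Fin N} {a : ℂ} {k : ℤ} (h : ∀ z : Circle, m i z = a * (z : ℂ) ^ k) :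
    ‖a‖ = 1 := by
  have h1 := hm.sum_root hN i i 1
  have h2 : ∀ z : Circle, m i z * conj (m i z) = ((‖a‖ ^ 2 : ℝ) : ℂ) := fun z => by
    rw [Complex.mul_conj, Complex.normSq_eq_norm_sq, h, norm_mul, norm_zpow, Circle.norm_coe]
    simp
  have hN' : (N : ℂ) ≠ 0 := by exact_mod_cast hN
  simp only [h2, Finset.sum_const, Finset.card_univ, Fintype.card_fin, nsmul_eq_mul, if_true,
    one_div, inv_mul_cancel_left₀ hN'] at h1
  have h3 : ‖a‖ ^ 2 = 1 := by exact_mod_cast h1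
  exact (pow_eq_one_iff_of_nonneg (norm_nonneg a) two_ne_zero).1 h3

/-- Under the low-pass condition no filter has constant modulus one. -/
theorem IsQMF.not_monomial_of_lowPass {N : ℕ} {m : Fin N → C(Circle, ℂ)} (hm : IsQMF m)
    (hN : 2 ≤ N) {i₀ : Fin N} (h0 : m i₀ 1 = ((Real.sqrt N : ℝ) : ℂ)) (i : Fin N) :
    ‖m i 1‖ ≠ 1 := by
  have hN' : (N : ℝ) ≠ 0 := by exact_mod_cast (show N ≠ 0 by omega)
  -- One column of the unitary filter matrix, read at `z = 1`: it gives `∑ |m_j(1)|² = N`.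
  have h1 := hm.sum_filter (by omega) ⟨0, by omega⟩ ⟨0, by omega⟩ 1
  simp only [pow_zero, one_mul, if_true, ← Complex.normSq_eq_conj_mul_self,
    Complex.normSq_eq_norm_sq, one_div] at h1
  have h2 : (N : ℝ)⁻¹ * ∑ j, ‖m j 1‖ ^ 2 = 1 := by
    apply Complex.ofReal_injective
    push_cast
    exact_mod_cast h1
  have h3 : ∑ j, ‖m j 1‖ ^ 2 = N := by
    field_simp at h2
    exact h2
  have h4 : ‖m i₀ 1‖ ^ 2 = N := by
    rw [h0, Complex.norm_real, Real.norm_of_nonneg (Real.sqrt_nonneg _),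
      Real.sq_sqrt (Nat.cast_nonneg N)]
  intro h5
  have hN2 : (2 : ℝ) ≤ N := by exact_mod_cast hN
  -- Modulus one would mean `N = 1` for the low-pass filter itself, and `1 + N ≤ N` for any other.
  by_cases hi : i = i₀
  · rw [← hi, h5] at h4
    linarith
  · have h6 : ∑ j ∈ {i, i₀}, ‖m j 1‖ ^ 2 ≤ ∑ j, ‖m j 1‖ ^ 2 :=
      Finset.sum_le_sum_of_subset_of_nonneg (Finset.subset_univ _) fun _ _ _ => by positivity
    rw [Finset.sum_pair hi, h3, h4, h5] at h6
    linarith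

/-! ### From monomial cycles to atoms -/

theorem toLp_circle_injective :
    Function.Injective (ContinuousMap.toLp (E := ℂ) 2 circleHaar ℂ) :=
  ContinuousMap.toLp_injective circleHaar

theorem circleFourier_ne_zero (n : ℤ) : circleFourier n ≠ 0 :=
  orthonormal_circleFourier.ne_zero n

theorem word_ofFn_circleFourier {N : ℕ} (hN : 2 ≤ N) {m : Fin N → C(Circle, ℂ)} (hm : IsQMF m)
    {p : ℕ} (i : Fin p → Fin N) (a : Fin p → Circle) (k : Fin p → ℤ)
    (h : ∀ (j : Fin p) (z : Circle), m (i j) z = (a j : ℂ) * (z : ℂ) ^ k j) (n : ℤ) :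
    (waveletRep hN m hm).word (List.ofFn i) (circleFourier n) =
      (∏ j, (a j : ℂ)) • circleFourier (∑ j : Fin p, (N : ℤ) ^ (j : ℕ) * k j + N ^ p * n) := by
  induction p with
  | zero => simp [CuntzRep.word]
  | succ p ih =>
    have h1 : (waveletRep hN m hm).word (List.ofFn i) (circleFourier n) =
        waveletOp hN (m (i 0)) ((waveletRep hN m hm).word (List.ofFn fun j => i j.succ)
          (circleFourier n)) := by
      rw [List.ofFn_succ, CuntzRep.word, List.map_cons, List.prod_cons]
      rfl
    -- The first letter acts last: it adds `k 0` and multiplies the exponent produced by the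
    -- remaining letters by `N`.
    rw [h1, ih (fun j => i j.succ) (fun j => a j.succ) (fun j => k j.succ) fun j => h j.succ,
      map_smul, waveletOp_circleFourier_of_monomial hN (h 0), smul_smul, Fin.prod_univ_succ,
      Fin.sum_univ_succ, mul_comm]
    congr 2
    simp only [Fin.val_zero, Fin.val_succ, pow_zero, one_mul, mul_add, Finset.mul_sum, pow_succ']
    simp only [mul_assoc, add_assoc]

theorem hasAtom_of_monomial_cycle {N : ℕ} (hN : 2 ≤ N) {m : Fin N → C(Circle, ℂ)} (hm : IsQMF m)
    {p : ℕ} (hp : 1 ≤ p) (i : Fin p → Fin N) (a : Fin p → Circle) (k : Fin p → ℤ)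
    (h : ∀ (j : Fin p) (z : Circle), m (i j) z = (a j : ℂ) * (z : ℂ) ^ k j)
    (hdvd : (N : ℤ) ^ p - 1 ∣ ∑ j : Fin p, (N : ℤ) ^ (j : ℕ) * k j) :
    (waveletRep hN m hm).HasAtom := by
  obtain ⟨s, hs⟩ := hdvd
  -- The exponent `-s` is the fixed point of `n ↦ (N^p - 1) s + N^p n`.
  refine (waveletRep hN m hm).hasAtom_of_word_apply_eq_smul hp i (circleFourier_ne_zero (-s))
    (c := ∏ j, (a j : ℂ)) (Finset.prod_ne_zero_iff.2 fun j _ => Circle.coe_ne_zero _) ?_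
  rw [word_ofFn_circleFourier hN hm i a k h, hs]
  congr 2
  ring

/-! ### From atoms to monomial cycles -/

theorem eventually_eq_zero_of_eq_add_mul {N : ℕ} (hN : 2 ≤ N) {d e : ℕ → ℕ}
    (h : ∀ n, d n = e n + d (n + 1) * N) : ∃ J, ∀ n, J ≤ n → d n = 0 ∧ e n = 0 := by
  have h1 : ∀ n, 2 * d (n + 1) ≤ d n := fun n => by
    rw [h n]
    nlinarith
  -- Subtraction is truncated: halving lowers a positive `d n` by at least one, and zero stays zero.
  have h2 : ∀ n, d n ≤ d 0 - n := by
    intro n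
    induction n with
    | zero => simp
    | succ n ih =>
      have := h1 n
      omega
  refine ⟨d 0, fun n hn => ?_⟩
  have h3 := h2 n
  have h4 := h n
  omega

/-- A sequence of nonzero trigonometric polynomials with `g_n(z) = m_{i_n}(z) g_{n+1}(z^N)`
consists of monomials from some index on, and so do the filters involved. -/
theorem exists_forall_monomial {N : ℕ} (hN : 2 ≤ N) {m : Fin N → C(Circle, ℂ)}
    (htrig : ∀ i, IsTrigPolynomial (m i)) (hm0 : ∀ i, m i ≠ 0) {η : ℕ → Fin N}
    {g : ℕ → C(Circle, ℂ)} (hg : ∀ n, IsTrigPolynomial (g n)) (hg0 : ∀ n, g n ≠ 0)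
    (h : ∀ n z, g n z = m (η n) z * g (n + 1) (z ^ N)) :
    ∃ J, ∀ n, J ≤ n → (∃ (a : ℂ) (k : ℤ), ∀ z : Circle, m (η n) z = a * (z : ℂ) ^ k) ∧
      ∃ (c : ℂ) (l : ℤ), c ≠ 0 ∧ ∀ z : Circle, g n z = c * (z : ℂ) ^ l := by
  choose d hd using fun n => (hg n).exists_hasWidth (hg0 n)
  choose e he using fun i => (htrig i).exists_hasWidth (hm0 i)
  -- The functional equation read on widths.
  have hde : ∀ n, d n = e (η n) + d (n + 1) * N := fun n => by
    refine (hd n).unique ?_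
    have h1 := (he (η n)).mul ((hd (n + 1)).comp_pow (N := N) (by omega))
    simpa only [← h] using h1
  obtain ⟨J, hJ⟩ := eventually_eq_zero_of_eq_add_mul hN hde
  refine ⟨J, fun n hn => ⟨?_, ?_⟩⟩
  · have h1 := he (η n)
    rw [(hJ n hn).2] at h1
    obtain ⟨a, k, -, hak⟩ := h1.eq_monomial
    exact ⟨a, k, hak⟩
  · have h1 := hd n
    rw [(hJ n hn).1] at h1
    exact h1.eq_monomial

theorem eq_of_monomial_eq_monomial {c b : ℂ} {l k : ℤ} (hc : c ≠ 0) (hb : b ≠ 0)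
    (h : ∀ z : Circle, c * (z : ℂ) ^ l = b * (z : ℂ) ^ k) : l = k := by
  refine (eq_of_zpow_mul_eval_eq (p := .C c) (q := .C b) (by simpa) (by simpa) fun z => ?_).1
  simpa [mul_comm] using h z

/-- A bounded solution of `l_n = k_n + N l_{n + 1}` yields a cycle. -/
theorem exists_cycle_dvd {N M : ℕ} {l k : ℕ → ℤ} (hl : ∀ n, l n ∈ Set.Icc (-M : ℤ) M)
    (h : ∀ n, l n = k n + N * l (n + 1)) :
    ∃ s p : ℕ, 1 ≤ p ∧ (N : ℤ) ^ p - 1 ∣ ∑ j : Fin p, (N : ℤ) ^ (j : ℕ) * k (s + j) := by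
  obtain ⟨s, t, hst, heq⟩ : ∃ s t, s < t ∧ l s = l t := by
    obtain ⟨s, -, t, -, hst, heq⟩ := Set.infinite_univ.exists_lt_map_eq_of_mapsTo
      (fun n _ => hl n) (Set.finite_Icc (-M : ℤ) M)
    exact ⟨s, t, hst, heq⟩
  have hsum : ∀ p, l s = ∑ j ∈ Finset.range p, (N : ℤ) ^ j * k (s + j) + N ^ p * l (s + p) := by
    intro p
    induction p with
    | zero => simp
    | succ p ih =>
      rw [Finset.sum_range_succ, ih, h (s + p), pow_succ, mul_add, ← mul_assoc, ← add_assoc,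
        add_assoc s p 1]
  -- Iterating from `s` to `t` gives `l s = ∑ + N^p l s` with `p = t - s`, so the sum is `(N^p - 1)
  -- (-l s)`.
  refine ⟨s, t - s, by omega, -l s, ?_⟩
  have h1 := hsum (t - s)
  rw [show s + (t - s) = t by omega, ← heq] at h1
  rw [Fin.sum_univ_eq_sum_range fun j => (N : ℤ) ^ j * k (s + j)]
  linear_combination -h1

theorem exists_monomial_cycle_of_hasAtom {N : ℕ} (hN : 2 ≤ N) {m : Fin N → C(Circle, ℂ)}
    (hm : IsQMF m) (htrig : ∀ i, IsTrigPolynomial (m i)) (hatom : (waveletRep hN m hm).HasAtom) :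
    ∃ (p : ℕ) (i : Fin p → Fin N) (a : Fin p → Circle) (k : Fin p → ℤ), 1 ≤ p ∧
      (∀ (j : Fin p) (z : Circle), m (i j) z = (a j : ℂ) * (z : ℂ) ^ k j) ∧
      (N : ℤ) ^ p - 1 ∣ ∑ j : Fin p, (N : ℤ) ^ (j : ℕ) * k j := by
  obtain ⟨ω, hω⟩ := hatom
  -- The monomials span a dense subspace, so a nonzero projection cannot vanish on all of them.
  -- Starting from a monomial puts the argument in a finite-dimensional space.
  obtain ⟨r, hr⟩ : ∃ r, (waveletRep hN m hm).pvm.proj {ω} (circleFourier r) ≠ 0 := by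
    by_contra! h
    refine hω (ContinuousLinearMap.ext_on (s := Set.range circleFourier) ?_ ?_)
    · rw [Submodule.dense_iff_topologicalClosure_eq_top]
      exact span_circleFourier_closure_eq_top
    · rintro _ ⟨n, rfl⟩
      exact h n
  obtain ⟨K, hK⟩ := exists_forall_star_waveletOp_mem_trigSpace hN htrig
  set M := max K r.natAbs with hM
  have hrM : r ∈ Set.Icc (-M : ℤ) M := by
    rw [Set.mem_Icc]
    omega
  obtain ⟨η, y, hy⟩ := (waveletRep hN m hm).exists_seq_of_isAtom (trigSpace M)
    (hK M (le_max_left _ _)) (Submodule.subset_span ⟨r, hrM, rfl⟩) hr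
  choose g hg hgy using fun n => exists_isTrigPolynomial_of_mem_trigSpace (hy n).1
  have hg0 : ∀ n, g n ≠ 0 := fun n h => (hy n).2.1 (by rw [← hgy, h, map_zero])
  have hrec : ∀ n z, g n z = m (η n) z * g (n + 1) (z ^ N) := by
    intro n z
    have h1 := (hy n).2.2
    rw [← hgy, ← hgy] at h1
    have h2 := toLp_circle_injective (h1.trans (waveletOp_toLp hN (m (η n)) (g (n + 1))))
    exact congrArg (fun f : C(Circle, ℂ) => f z) h2
  obtain ⟨J, hJ⟩ := exists_forall_monomial hN htrig hm.ne_zero hg hg0 hrec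
  choose a k hak using fun n => (hJ (J + n) (Nat.le_add_right _ _)).1
  choose c l hc hcl using fun n => (hJ (J + n) (Nat.le_add_right _ _)).2
  have ha : ∀ n, ‖a n‖ = 1 := fun n => hm.norm_eq_one_of_monomial (by omega) (hak n)
  have ha0 : ∀ n, a n ≠ 0 := fun n => by
    rw [← norm_pos_iff, ha]
    exact one_pos
  -- Outside the interval, membership of `y (J + n)` in `trigSpace M` would force its only Fourier
  -- coefficient `c n` to vanish.
  have hlM : ∀ n, l n ∈ Set.Icc (-M : ℤ) M := by
    intro n
    by_contra hn
    have h1 := mem_trigSpace_iff.1 (hy (J + n)).1 (l n) hn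
    have h2 : y (J + n) = c n • circleFourier (l n) := by
      rw [← hgy, circleFourier, ← map_smul]
      congr 1
      ext z
      simp [hcl, circleMonomial_apply]
    rw [h2, inner_smul_right, orthonormal_iff_ite.1 orthonormal_circleFourier, if_pos rfl,
      mul_one] at h1
    exact hc n h1
  have hlk : ∀ n, l n = k n + N * l (n + 1) := by
    intro n
    refine eq_of_monomial_eq_monomial (hc n) (mul_ne_zero (ha0 n) (hc (n + 1))) fun z => ?_
    rw [← hcl, hrec, hak, add_assoc, hcl, Circle.coe_pow, zpow_add₀ (Circle.coe_ne_zero z),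
      zpow_mul, zpow_natCast]
    ring
  obtain ⟨s, p, hp, hdvd⟩ := exists_cycle_dvd hlM hlk
  exact ⟨p, fun j => η (J + (s + j)), fun j => ⟨a (s + j), by simp [Submonoid.unitSphere, ha]⟩,
    fun j => k (s + j), hp, fun j => hak (s + j), hdvd⟩

theorem theorem5 (N : ℕ) (hN : 2 ≤ N) (m : Fin N → C(Circle, ℂ)) (hm : IsQMF m)
    (htrig : ∀ i, IsTrigPolynomial (m i)) :
    ((waveletRep hN m hm).HasAtom ↔
      ∃ (p : ℕ) (i : Fin p → Fin N) (a : Fin p → Circle) (k : Fin p → ℤ), 1 ≤ p ∧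
        (∀ (j : Fin p) (z : Circle), m (i j) z = (a j : ℂ) * (z : ℂ) ^ k j) ∧
        (N : ℤ) ^ p - 1 ∣ ∑ j : Fin p, (N : ℤ) ^ (j : ℕ) * k j) ∧
    (m ⟨0, by omega⟩ 1 = ((Real.sqrt N : ℝ) : ℂ) → ¬ (waveletRep hN m hm).HasAtom) := by
  refine ⟨⟨exists_monomial_cycle_of_hasAtom hN hm htrig, ?_⟩, fun h0 hatom => ?_⟩
  · rintro ⟨p, i, a, k, hp, h, hdvd⟩
    exact hasAtom_of_monomial_cycle hN hm hp i a k h hdvd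
  · obtain ⟨p, i, a, k, hp, h, -⟩ := exists_monomial_cycle_of_hasAtom hN hm htrig hatom
    -- The cycle is nonempty, so its first filter is a monomial with unimodular coefficient and has
    -- modulus one at `1`.
    refine hm.not_monomial_of_lowPass hN h0 (i ⟨0, hp⟩) ?_
    rw [h, norm_mul, norm_zpow, Circle.norm_coe, Circle.norm_coe, one_zpow, one_mul]
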